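/- All posets are finite. A poset is graded (of rank $n$) if all its maximal chains have the same length $n$ (that is, $n+1$ elements); its rank function $\rho$ assigns to $x$ the length of the longest chain ending in $x$. A finite poset $P$ with least element $\hat 0$ and greatest element $\hat 1$ is called \emph{binomial} if every interval $[x,y]$ of $P$ is graded and any two intervals of the same rank have the same number of maximal chains. A graded poset is called \emph{Eulerian} if every interval $[x,y]$ with $x<y$ contains as many elements of even rank as elements of odd rank. Let $B_n$ be the poset of subsets of $\{1,\dots,n\}$ ordered by inclusion. Let $T_n$ (the butterfly poset of rank $n\ge 1$) be the poset on $\{\hat 0\}\cup(\{1,\dots,n-1\}\times\{1,2\})\cup\{\hat 1\}$ in which $\hat 0$ is the least element, $\hat 1$ is the greatest element, and $(a,i)<(b,j)$ if and only if $a<b$. For a poset $Q$ with $\hat 0$ and $\hat 1$ and a positive integer $k$, the $k$-summation $\boxplus^k(Q)$ is the poset obtained from the disjoint union of $k$ copies of $Q$ by identifying all the minimal elements $\hat 0$ with each other and all the maximal elements $\hat 1$ with each other. \textbf{Theorem.} Let $P$ be a finite Eulerian binomial poset of odd rank $n=2m+1\ge 5$. Then one of the following holds: (i) there is a positive integer $k$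 such that $P\cong\boxplus^k(B_n)$; (ii) there is a positive integer $k$ such that $P\cong\boxplus^k(T_n)$. -/

import Mathlib

namespace FinPoset

/-- `α` is graded of rank `n`: all maximal chains have length `n`, i.e. `n + 1` elements. -/
def HasRank (α : Type*) [PartialOrder α] (n : ℕ) : Prop :=
  ∀ C : Flag α, (C : Set α).ncard = n + 1

/-- `α` is graded: all maximal chains have the same length. -/
def IsGraded (α : Type*) [PartialOrder α] : Prop :=
  ∃ n : ℕ, HasRank α n

/-- The rank `ρ(x)` of an element: the length of the longest chain ending in `x`. In a finite
graded poset this is the rank function. -/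
noncomputable def rk {P : Type*} [PartialOrder P] (x : P) : ℕ :=
  (Order.height x).toNat

/-- The number of maximal chains of the interval `[x, y]`. -/
noncomputable def numMaxChains {P : Type*} [PartialOrder P] (x y : P) : ℕ :=
  Nat.card (Flag (Set.Icc x y))

/-- A finite poset with `⊥` and `⊤` is binomial if every interval is graded and any two intervals
of the same rank have the same number of maximal chains. -/
structure IsBinomial (P : Type*) [PartialOrder P] [BoundedOrder P] [Finite P] : Prop where
  graded : ∀ x y : P, x ≤ y → IsGraded (Set.Icc x y)
  numMaxChains_eq : ∀ (n : ℕ) (x y u v : P), x ≤ y → u ≤ v →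
    HasRank (Set.Icc x y) n → HasRank (Set.Icc u v) n →
    numMaxChains x y = numMaxChains u v

/-- A finite graded poset is Eulerian if every non-singleton interval has as many elements of even
rank as of odd rank. -/
structure IsEulerian (P : Type*) [PartialOrder P] [BoundedOrder P] [Finite P] : Prop where
  graded : IsGraded P
  euler_poincare : ∀ x y : P, x < y →
    {z : P | z ∈ Set.Icc x y ∧ Even (rk z)}.ncard = {z : P | z ∈ Set.Icc x y ∧ Odd (rk z)}.ncard

/-- The disjoint union of `k` copies of `P`. -/
@[ext]
structure Copies (k : ℕ) (P : Type*) where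
  copy : Fin k
  elt : P

/-- The preorder on `k` copies of `P` in which the order of each copy is kept, all copies of `⊥`
lie below everything and all copies of `⊤` lie above everything. -/
instance Copies.instPreorder (k : ℕ) (P : Type*) [PartialOrder P] [BoundedOrder P] :
    Preorder (Copies k P) where
  le a b := a.elt = ⊥ ∨ b.elt = ⊤ ∨ (a.copy = b.copy ∧ a.elt ≤ b.elt)
  le_refl a := Or.inr (Or.inr ⟨rfl, le_rfl⟩)
  le_trans a b c := by
    rintro (h | h | ⟨h, h'⟩) (g | g | ⟨g, g'⟩)
    · exact Or.inl h
    · exact Or.inl h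
    · exact Or.inl h
    · refine Or.inr (Or.inl (top_le_iff.1 ?_))
      rw [← h, g]
      exact bot_le
    · exact Or.inr (Or.inl g)
    · rw [h] at g'
      exact Or.inr (Or.inl (top_le_iff.1 g'))
    · rw [g] at h'
      exact Or.inl (le_bot_iff.1 h')
    · exact Or.inr (Or.inl g)
    · exact Or.inr (Or.inr ⟨h.trans g, h'.trans g'⟩)

/-- The `k`-summation of `P`: the poset obtained from `k` copies of `P` by identifying all the
minimal elements and all the maximal elements. -/
abbrev KSum (k : ℕ) (P : Type*) [PartialOrder P] [BoundedOrder P] : Type _ :=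
  Antisymmetrization (Copies k P) (· ≤ ·)

/-- Two elements of the disjoint union become equal in the `k`-summation exactly if they are
equal, both minimal or both maximal. -/
theorem KSum.mk_eq_iff {k : ℕ} {P : Type*} [PartialOrder P] [BoundedOrder P] [Nontrivial P]
    (a b : Copies k P) :
    toAntisymmetrization (· ≤ ·) a = toAntisymmetrization (· ≤ ·) b ↔
      a = b ∨ (a.elt = ⊥ ∧ b.elt = ⊥) ∨ (a.elt = ⊤ ∧ b.elt = ⊤) := by
  have key : toAntisymmetrization (· ≤ ·) a = toAntisymmetrization (· ≤ ·) b ↔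
      AntisymmRel (· ≤ ·) a b := Quotient.eq
  rw [key]
  constructor
  · rintro ⟨h | h | ⟨h, h'⟩, g | g | ⟨g, g'⟩⟩
    · exact Or.inr (Or.inl ⟨h, g⟩)
    · exact absurd (h.symm.trans g) bot_ne_top
    · rw [h] at g'
      exact Or.inr (Or.inl ⟨h, le_bot_iff.1 g'⟩)
    · exact absurd (g.symm.trans h) bot_ne_top
    · exact Or.inr (Or.inr ⟨g, h⟩)
    · rw [h] at g'
      exact Or.inr (Or.inr ⟨top_le_iff.1 g', h⟩)
    · rw [g] at h'
      exact Or.inr (Or.inl ⟨le_bot_iff.1 h', g⟩)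
    · rw [g] at h'
      exact Or.inr (Or.inr ⟨g, top_le_iff.1 h'⟩)
    · exact Or.inl (Copies.ext h (le_antisymm h' g'))
  · rintro (rfl | ⟨h, g⟩ | ⟨h, g⟩)
    · exact ⟨le_rfl, le_rfl⟩
    · exact ⟨Or.inl h, Or.inl g⟩
    · exact ⟨Or.inr (Or.inl g), Or.inr (Or.inl h)⟩

/-- The boolean lattice of rank `n`: the subsets of an `n`-element set, ordered by inclusion. -/
abbrev BooleanLattice (n : ℕ) : Type := Finset (Fin n)

/-- The proper part of the butterfly poset: `l` levels with two elements each. -/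
@[ext]
structure ButterflyCore (l : ℕ) where
  level : Fin l
  side : Fin 2

/-- Each element lies below both elements of every higher level, and the two elements of one level
are incomparable. -/
instance ButterflyCore.instPartialOrder (l : ℕ) : PartialOrder (ButterflyCore l) where
  le a b := a = b ∨ a.level < b.level
  le_refl a := Or.inl rfl
  le_trans a b c := by
    rintro (rfl | h) (rfl | g)
    · exact Or.inl rfl
    · exact Or.inr g
    · exact Or.inr h
    · exact Or.inr (h.trans g)
  le_antisymm a b := by
    rintro (h | h) (g | g)
    · exact h
    · exact h
    · exact g.symm
    · exact absurd g h.asymm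

/-- The butterfly poset `T_n` of rank `n ≥ 1`: two elements in each of the ranks `1, …, n - 1`,
together with a least and a greatest element. -/
abbrev Butterfly (n : ℕ) : Type := WithBot (WithTop (ButterflyCore (n - 1)))

end FinPoset

/-! Let `A r` be the number of atoms, and of coatoms, of an interval of rank `r`. Counting cover
relations between consecutive levels expresses the level sizes through `A`. The Euler relation in
rank `2 * j`, compared with the one for the Boolean lattice or the butterfly poset, then leaves two
possibilities for `A (2 * j - 1)` and `A (2 * j)`: by induction `A i = i` for all `1 ≤ i < n`, or
`A i = 2` for all `2 ≤ i < n`. Since `n` is odd, this covers every proper interval.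

Link two atoms when they have a common upper bound below `⊤`. In both cases this is an equivalence
relation, and `P` is the summation of the subposets spanned by its classes. In the first case proper
intervals are Boolean: an element of a summand is determined by the atoms below it, and each class
has `n` atoms. In the second case any two elements of different rank in a summand are comparable. -/

namespace FinPoset

section MaximalChains

variable {P : Type*} [PartialOrder P] {x y a b : P} {C : Set P}

/-- `C` is a maximal chain of the interval `[x, y]`, as a set of elements of `P` rather than of
the subtype, so that maximal chains of different intervals can be compared. -/
structure IsMaxChainIn (x y : P) (C : Set P) : Prop where
  subset : C ⊆ Set.Icc x y
  total : ∀ a ∈ C, ∀ b ∈ C, a ≤ b ∨ b ≤ a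
  maximal : ∀ z ∈ Set.Icc x y, (∀ c ∈ C, z ≤ c ∨ c ≤ z) → z ∈ C

namespace IsMaxChainIn

theorem left_mem (h : IsMaxChainIn x y C) (hxy : x ≤ y) : x ∈ C :=
  h.maximal x ⟨le_rfl, hxy⟩ fun _ hc => Or.inl (h.subset hc).1

theorem right_mem (h : IsMaxChainIn x y C) (hxy : x ≤ y) : y ∈ C :=
  h.maximal y ⟨hxy, le_rfl⟩ fun _ hc => Or.inr (h.subset hc).2

theorem eq_singleton (h : IsMaxChainIn x x C) : C = {x} :=
  Set.Subset.antisymm (by simpa using h.subset) (by simpa using h.left_mem le_rfl)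

theorem dual (h : IsMaxChainIn x y C) :
    IsMaxChainIn (P := Pᵒᵈ) (OrderDual.toDual y) (OrderDual.toDual x) (OrderDual.ofDual ⁻¹' C) where
  subset _ hc := ⟨(h.subset hc).2, (h.subset hc).1⟩
  total _ ha _ hb := (h.total _ ha _ hb).symm
  maximal z hz hc := h.maximal z ⟨hz.2, hz.1⟩ fun c hc' => (hc c hc').symm

theorem insert_left (hxa : x ⋖ a) (hay : a ≤ y) (h : IsMaxChainIn a y C) :
    IsMaxChainIn x y (insert x C) where
  subset := by
    rintro c (rfl | hc)
    · exact ⟨le_rfl, hxa.le.trans hay⟩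
    · exact ⟨hxa.le.trans (h.subset hc).1, (h.subset hc).2⟩
  total := by
    rintro c (rfl | hc) d (rfl | hd)
    · exact Or.inl le_rfl
    · exact Or.inl (hxa.le.trans (h.subset hd).1)
    · exact Or.inr (hxa.le.trans (h.subset hc).1)
    · exact h.total c hc d hd
  maximal := by
    intro z hz hzC
    rcases hz.1.eq_or_lt with rfl | hxz
    · exact Or.inl rfl
    · have haz : a ≤ z := (hzC a (Or.inr (h.left_mem hay))).elim
        (fun hza => (hza.eq_or_lt.resolve_right (hxa.2 hxz)).ge) id
      exact Or.inr (h.maximal z ⟨haz, hz.2⟩ fun c hc => hzC c (Or.inr hc))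

theorem insert_right (hby : b ⋖ y) (hxb : x ≤ b) (h : IsMaxChainIn x b C) :
    IsMaxChainIn x y (insert y C) :=
  (insert_left (P := Pᵒᵈ) hby.toDual hxb h.dual).dual

theorem left_notMem (hxa : x < a) (h : IsMaxChainIn a y C) : x ∉ C :=
  fun hx => hxa.not_ge (h.subset hx).1

theorem right_notMem (hby : b < y) (h : IsMaxChainIn x b C) : y ∉ C :=
  fun hy => hby.not_ge (h.subset hy).2

theorem left_unique (hay : a ≤ y) (hby : b ≤ y) (ha : IsMaxChainIn a y C)
    (hb : IsMaxChainIn b y C) : a = b :=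
  le_antisymm (ha.subset (hb.left_mem hby)).1 (hb.subset (ha.left_mem hay)).1

theorem exists_sdiff_left [Finite P] (h : IsMaxChainIn x y C) (hxy : x < y) :
    ∃ a, x ⋖ a ∧ a ≤ y ∧ IsMaxChainIn a y (C \ {x}) := by
  obtain ⟨a, ha, hmin⟩ := (Set.toFinite (C \ {x})).exists_minimal
    ⟨y, h.right_mem hxy.le, fun hyx => hxy.ne' hyx⟩
  replace hmin : ∀ c ∈ C \ {x}, a ≤ c := fun c hc => (h.total a ha.1 c hc.1).elim id (hmin hc)
  have hxa : x < a := (h.subset ha.1).1.lt_of_ne' ha.2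
  have mem_of_comparable : ∀ z ∈ Set.Icc x y, (∀ c ∈ C \ {x}, z ≤ c ∨ c ≤ z) → z ∈ C :=
    fun z hz hzC => h.maximal z hz fun c hc => by
      by_cases hcx : c = x
      · exact Or.inr (hcx ▸ hz.1)
      · exact hzC c ⟨hc, hcx⟩
  refine ⟨a, ⟨hxa, fun z hxz hza => ?_⟩, (h.subset ha.1).2,
    fun c hc => ⟨hmin c hc, (h.subset hc.1).2⟩, fun c hc d hd => h.total c hc.1 d hd.1,
    fun z hz hzC => ⟨mem_of_comparable z ⟨hxa.le.trans hz.1, hz.2⟩ hzC, (hxa.trans_le hz.1).ne'⟩⟩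
  have hzC : z ∈ C := mem_of_comparable z ⟨hxz.le, hza.le.trans (h.subset ha.1).2⟩
    fun c hc => Or.inl (hza.le.trans (hmin c hc))
  exact hza.not_ge (hmin z ⟨hzC, hxz.ne'⟩)

end IsMaxChainIn

/-- The flags of the subtype `[x, y]` are the maximal chains of `[x, y]` as subsets of `P`. -/
def flagIccEquiv (x y : P) : Flag (Set.Icc x y) ≃ {C : Set P // IsMaxChainIn x y C} where
  toFun F := ⟨Subtype.val '' (F : Set (Set.Icc x y)), {
    subset := by rintro _ ⟨c, -, rfl⟩; exact c.2
    total := by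
      rintro _ ⟨c, hc, rfl⟩ _ ⟨d, hd, rfl⟩
      exact F.le_or_le hc hd
    maximal := fun z hz hzF =>
      ⟨⟨z, hz⟩, Flag.mem_iff_forall_le_or_ge.2 fun {c} hc => hzF c ⟨c, hc, rfl⟩, rfl⟩ }⟩
  invFun C :=
    { carrier := Subtype.val ⁻¹' C.1
      Chain' := fun a ha b hb _ => C.2.total _ ha _ hb
      max_chain' := fun s hs hCs => hCs.antisymm fun z hz =>
        C.2.maximal z z.2 fun c hc => hs.total hz (hCs (a := ⟨c, C.2.subset hc⟩) hc) }
  left_inv F := by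
    ext z
    simp
  right_inv C := Subtype.ext <|
    Set.image_preimage_eq_of_subset <| C.2.subset.trans Subtype.range_coe.superset

theorem numMaxChains_eq_card (x y : P) :
    numMaxChains x y = Nat.card {C : Set P // IsMaxChainIn x y C} :=
  Nat.card_congr (flagIccEquiv x y)

theorem hasRank_Icc_iff {n : ℕ} :
    HasRank (Set.Icc x y) n ↔ ∀ C : Set P, IsMaxChainIn x y C → C.ncard = n + 1 := by
  have ncard_flagIccEquiv (F : Flag (Set.Icc x y)) :
      (flagIccEquiv x y F).1.ncard = (F : Set (Set.Icc x y)).ncard :=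
    Set.ncard_image_of_injective _ Subtype.val_injective
  refine ⟨fun h C hC => ?_, fun h F => ?_⟩
  · rw [← h ((flagIccEquiv x y).symm ⟨C, hC⟩), ← ncard_flagIccEquiv, Equiv.apply_symm_apply]
  · rw [← ncard_flagIccEquiv]
    exact h _ (flagIccEquiv x y F).2

theorem exists_isMaxChainIn (x y : P) : ∃ C, IsMaxChainIn x y C := by
  obtain ⟨F⟩ : Nonempty (Flag (Set.Icc x y)) := inferInstance
  exact ⟨_, (flagIccEquiv x y F).2⟩

theorem numMaxChains_pos [Finite P] (x y : P) : 0 < numMaxChains x y :=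
  Nat.card_pos

theorem numMaxChains_dual (x y : P) :
    numMaxChains (OrderDual.toDual y) (OrderDual.toDual x) = numMaxChains x y := by
  simp only [numMaxChains_eq_card]
  exact Nat.card_congr
    { toFun := fun C => ⟨OrderDual.toDual ⁻¹' C.1, C.2.dual⟩
      invFun := fun C => ⟨OrderDual.ofDual ⁻¹' C.1, C.2.dual⟩
      left_inv := fun _ => rfl
      right_inv := fun _ => rfl }

theorem bijective_insert_left [Finite P] (hxy : x < y) :
    Function.Bijective
      fun p : Σ a : {a : P // x ⋖ a ∧ a ≤ y}, {C : Set P // IsMaxChainIn a.1 y C} =>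
        (⟨insert x p.2.1, p.2.2.insert_left p.1.2.1 p.1.2.2⟩ :
          {C : Set P // IsMaxChainIn x y C}) := by
  constructor
  · rintro ⟨⟨a, hxa, hay⟩, C, hC⟩ ⟨⟨b, hxb, hby⟩, D, hD⟩ h
    replace h : insert x C = insert x D := congrArg Subtype.val h
    obtain rfl : C = D := by
      rw [← Set.insert_sdiff_self_of_notMem (hC.left_notMem hxa.lt), h,
        Set.insert_sdiff_self_of_notMem (hD.left_notMem hxb.lt)]
    obtain rfl := hC.left_unique hay hby hD
    rfl
  · rintro ⟨C, hC⟩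
    obtain ⟨a, hxa, hay, ha⟩ := hC.exists_sdiff_left hxy
    exact ⟨⟨⟨a, hxa, hay⟩, _, ha⟩, by simp [Set.insert_eq_of_mem (hC.left_mem hxy.le)]⟩

theorem numMaxChains_eq_card_covers_mul [Finite P] (hxy : x < y) {N : ℕ}
    (hN : ∀ a, x ⋖ a → a ≤ y → numMaxChains a y = N) :
    numMaxChains x y = Nat.card {a : P // x ⋖ a ∧ a ≤ y} * N := by
  have := Fintype.ofFinite {a : P // x ⋖ a ∧ a ≤ y}
  calc numMaxChains x y
      = ∑ a : {a : P // x ⋖ a ∧ a ≤ y}, numMaxChains a.1 y := by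
        simp only [numMaxChains_eq_card]
        rw [← Nat.card_eq_of_bijective _ (bijective_insert_left hxy), Nat.card_sigma]
    _ = Nat.card {a : P // x ⋖ a ∧ a ≤ y} * N := by
        rw [Finset.sum_congr rfl fun a _ => hN a.1 a.2.1 a.2.2]
        simp [Nat.card_eq_fintype_card]

theorem numMaxChains_eq_card_cocovers_mul [Finite P] (hxy : x < y) {N : ℕ}
    (hN : ∀ b, x ≤ b → b ⋖ y → numMaxChains x b = N) :
    numMaxChains x y = Nat.card {b : P // x ≤ b ∧ b ⋖ y} * N := by
  rw [← numMaxChains_dual, numMaxChains_eq_card_covers_mul (P := Pᵒᵈ) (x := OrderDual.toDual y)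
    (y := OrderDual.toDual x) hxy fun a ha ha' =>
      (numMaxChains_dual x (OrderDual.ofDual a)).trans (hN (OrderDual.ofDual a) ha' ha.ofDual)]
  congr 1
  exact Nat.card_congr
    { toFun := fun a => ⟨OrderDual.ofDual a.1, a.2.2, a.2.1.ofDual⟩
      invFun := fun b => ⟨OrderDual.toDual b.1, b.2.2.toDual, b.2.1⟩
      left_inv := fun _ => rfl
      right_inv := fun _ => rfl }

end MaximalChains

section Grading

variable {P : Type*} [PartialOrder P] [BoundedOrder P] [Finite P]

/-- A binomial poset is graded by the rank of the intervals `[⊥, x]`. -/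
@[reducible]
noncomputable def IsBinomial.gradeMinOrder (hB : IsBinomial P) : GradeMinOrder ℕ P :=
  have ncard_eq (x : P) {C : Set P} (hC : IsMaxChainIn ⊥ x C) :
      C.ncard = (hB.graded ⊥ x bot_le).choose + 1 :=
    hasRank_Icc_iff.1 (hB.graded ⊥ x bot_le).choose_spec C hC
  have choose_covBy {x y : P} (hxy : x ⋖ y) :
      (hB.graded ⊥ x bot_le).choose + 1 = (hB.graded ⊥ y bot_le).choose := by
    obtain ⟨C, hC⟩ := exists_isMaxChainIn ⊥ x
    have hC' := ncard_eq y (hC.insert_right hxy bot_le)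
    rw [Set.ncard_insert_of_notMem (hC.right_notMem hxy.lt), ncard_eq x hC] at hC'
    omega
  { grade := fun x => (hB.graded ⊥ x bot_le).choose
    grade_strictMono := by
      classical
      have := Fintype.ofFinite P
      have : LocallyFiniteOrder P := Fintype.toLocallyFiniteOrder
      exact (strictMono_iff_forall_covBy _).2 fun x y hxy => by
        have := choose_covBy hxy
        omega
    covBy_grade := fun _ _ hxy => Nat.covBy_iff_add_one_eq.2 (choose_covBy hxy)
    isMin_grade := fun x hx => by
      obtain rfl := hx.eq_bot
      obtain ⟨C, hC⟩ := exists_isMaxChainIn (⊥ : P) ⊥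
      have := ncard_eq ⊥ hC
      rw [hC.eq_singleton, Set.ncard_singleton] at this
      rw [isMin_iff_eq_bot, Nat.bot_eq_zero]
      omega }

end Grading

section Graded

variable {P : Type*} [PartialOrder P] [GradeOrder ℕ P] {x y : P}

theorem grade_eq_succ_of_covBy (hxy : x ⋖ y) : grade ℕ y = grade ℕ x + 1 :=
  (Nat.covBy_iff_add_one_eq.1 (hxy.grade ℕ)).symm

theorem covBy_of_le_of_grade_eq_succ (hxy : x ≤ y) (h : grade ℕ y = grade ℕ x + 1) : x ⋖ y :=
  covBy_iff_lt_covBy_grade.2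
    ⟨hxy.lt_of_ne (by rintro rfl; omega), Nat.covBy_iff_add_one_eq.2 h.symm⟩

theorem eq_of_le_of_grade_le (hxy : x ≤ y) (h : grade ℕ y ≤ grade ℕ x) : x = y :=
  hxy.eq_of_not_lt fun hlt => (grade_strictMono hlt).not_ge h

theorem lt_of_le_of_grade_lt (hxy : x ≤ y) (h : grade ℕ x < grade ℕ y) : x < y :=
  hxy.lt_of_ne (by rintro rfl; exact h.false)

theorem exists_mem_Icc_grade_eq (hxy : x ≤ y) {i : ℕ} (hx : grade ℕ x ≤ i)
    (hy : i ≤ grade ℕ y) : ∃ z ∈ Set.Icc x y, grade ℕ z = i := by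
  induction i, hx using Nat.le_induction with
  | base => exact ⟨x, ⟨le_rfl, hxy⟩, rfl⟩
  | succ i _ ih =>
    obtain ⟨z, ⟨hxz, hzy⟩, rfl⟩ := ih (by omega)
    obtain ⟨c, hzc, hcy⟩ := exists_covBy_le_of_lt (lt_of_le_of_grade_lt hzy hy)
    exact ⟨c, ⟨hxz.trans hzc.le, hcy⟩, grade_eq_succ_of_covBy hzc⟩

theorem hasRank_Icc [Finite P] (hxy : x ≤ y) :
    HasRank (Set.Icc x y) (grade ℕ y - grade ℕ x) := by
  rw [hasRank_Icc_iff]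
  induction x using WellFoundedGT.induction with
  | ind x ih =>
    intro C hC
    rcases hxy.eq_or_lt with rfl | hlt
    · simp [hC.eq_singleton]
    · obtain ⟨a, hxa, hay, ha⟩ := hC.exists_sdiff_left hlt
      have hncard := ih a hxa.lt hay _ ha
      rw [Set.ncard_sdiff_singleton_of_mem (hC.left_mem hxy), grade_eq_succ_of_covBy hxa] at hncard
      have := grade_eq_succ_of_covBy hxa
      have := grade_mono (𝕆 := ℕ) hay
      omega

end Graded

theorem grade_eq_one {P : Type*} [PartialOrder P] [OrderBot P] [GradeMinOrder ℕ P] {a : P}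
    (ha : IsAtom a) : grade ℕ a = 1 := by
  rw [grade_eq_succ_of_covBy ha.bot_covBy, grade_bot, Nat.bot_eq_zero]

section GradedBounded

variable {P : Type*} [PartialOrder P] [BoundedOrder P] [GradeMinOrder ℕ P]

theorem exists_bot_lt_grade_eq {r : ℕ} (hr0 : 0 < r) (hr : r ≤ grade ℕ (⊤ : P)) :
    ∃ w : P, ⊥ < w ∧ grade ℕ w = grade ℕ (⊥ : P) + r := by
  obtain ⟨w, -, hw⟩ := exists_mem_Icc_grade_eq (bot_le : (⊥ : P) ≤ ⊤) (grade_bot.trans_le bot_le) hr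
  rw [grade_bot, Nat.bot_eq_zero, Nat.zero_add]
  exact ⟨w, lt_of_le_of_grade_lt bot_le (by rwa [grade_bot, hw]), hw⟩

variable [Finite P]

theorem rk_eq_grade (x : P) : rk x = grade ℕ x := by
  suffices Order.height x = grade ℕ x by rw [rk, this, ENat.toNat_natCast]
  refine le_antisymm ?_ ?_
  · simpa using Order.height_le_height_apply_of_strictMono _ (grade_strictMono (𝕆 := ℕ)) x
  · induction x using WellFoundedLT.induction with
    | ind x ih =>
      rcases (bot_le : ⊥ ≤ x).eq_or_lt with rfl | hx
      · simp
      · obtain ⟨c, -, hcx⟩ := exists_le_covBy_of_lt hx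
        rw [grade_eq_succ_of_covBy hcx, Nat.cast_succ]
        exact (add_le_add_left (ih c hcx.lt) 1).trans (Order.height_add_one_le hcx.lt)

theorem grade_top_of_hasRank {n : ℕ} (h : HasRank P n) : grade ℕ (⊤ : P) = n := by
  obtain ⟨C, hC⟩ := exists_isMaxChainIn (⊥ : P) ⊤
  have hCn : C.ncard = n + 1 := h
    { carrier := C
      Chain' := fun a ha b hb _ => hC.total a ha b hb
      max_chain' := fun s hs hCs => hCs.antisymm fun z hz =>
        hC.maximal z ⟨bot_le, le_top⟩ fun c hc => hs.total hz (hCs hc) }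
  have hC' := hasRank_Icc_iff.1 (hasRank_Icc (bot_le : (⊥ : P) ≤ ⊤)) C hC
  simp only [grade_bot, Nat.bot_eq_zero] at hC'
  omega

end GradedBounded

section IntervalCounting

open scoped Classical in
/-- The atoms of the interval `[x, y]`. -/
noncomputable def intervalAtoms {P : Type*} [PartialOrder P] [Fintype P] (x y : P) : Finset P :=
  {a | x ⋖ a ∧ a ≤ y}

open scoped Classical in
/-- The coatoms of the interval `[x, y]`. -/
noncomputable def intervalCoatoms {P : Type*} [PartialOrder P] [Fintype P] (x y : P) : Finset P :=
  {b | x ≤ b ∧ b ⋖ y}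

open scoped Classical in
/-- The elements of rank `i` of the interval `[x, y]`, whose own grading starts at `x`. -/
noncomputable def level {P : Type*} [PartialOrder P] [Fintype P] [GradeOrder ℕ P] (x y : P)
    (i : ℕ) : Finset P :=
  {z | x ≤ z ∧ z ≤ y ∧ grade ℕ z = grade ℕ x + i}

variable {P : Type*} [PartialOrder P] [Fintype P] {x y a b z : P} {r i : ℕ}

@[simp]
theorem mem_intervalAtoms : a ∈ intervalAtoms x y ↔ x ⋖ a ∧ a ≤ y := by simp [intervalAtoms]

@[simp]
theorem mem_intervalCoatoms : b ∈ intervalCoatoms x y ↔ x ≤ b ∧ b ⋖ y := by simp [intervalCoatoms]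

theorem intervalAtoms_mono (hab : a ≤ b) : intervalAtoms x a ⊆ intervalAtoms x b := fun _ hc =>
  mem_intervalAtoms.2 ⟨(mem_intervalAtoms.1 hc).1, (mem_intervalAtoms.1 hc).2.trans hab⟩

variable [GradeOrder ℕ P]

@[simp]
theorem mem_level : z ∈ level x y i ↔ x ≤ z ∧ z ≤ y ∧ grade ℕ z = grade ℕ x + i := by simp [level]

theorem level_zero (hxy : x ≤ y) : level x y 0 = {x} := by
  ext z
  simp only [mem_level, Finset.mem_singleton]
  constructor
  · rintro ⟨hxz, -, hz⟩
    exact (eq_of_le_of_grade_le hxz hz.le).symm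
  · rintro rfl
    exact ⟨le_rfl, hxy, rfl⟩

theorem level_self (hxy : x ≤ y) (hr : grade ℕ y = grade ℕ x + r) : level x y r = {y} := by
  ext z
  simp only [mem_level, Finset.mem_singleton]
  constructor
  · rintro ⟨-, hzy, hz⟩
    exact eq_of_le_of_grade_le hzy (hr.trans hz.symm).le
  · rintro rfl
    exact ⟨hxy, le_rfl, hr⟩

end IntervalCounting

theorem IsEulerian.sum_card_level {P : Type*} [PartialOrder P] [BoundedOrder P] [Fintype P]
    [GradeMinOrder ℕ P] (hE : IsEulerian P) {x y : P} {r : ℕ} (hxy : x < y)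
    (hr : grade ℕ y = grade ℕ x + r) :
    ∑ i ∈ Finset.range (r + 1), (-1 : ℤ) ^ i * (level x y i).card = 0 := by
  classical
  let s : Finset P := {z | z ∈ Set.Icc x y}
  have sum_eq_zero : ∑ z ∈ s, (-1 : ℤ) ^ grade ℕ z = 0 := by
    have hcard := hE.euler_poincare x y hxy
    simp only [rk_eq_grade, Set.ncard_eq_toFinset_card', Set.toFinset_ofPred, Set.mem_Icc] at hcard
    rw [← Finset.sum_filter_add_sum_filter_not s (fun z => Even (grade ℕ z)),
      Finset.sum_congr rfl fun z hz => (Finset.mem_filter.1 hz).2.neg_one_pow,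
      Finset.sum_congr (s₁ := s.filter fun z => ¬ Even (grade ℕ z)) rfl fun z hz =>
        (Nat.not_even_iff_odd.1 (Finset.mem_filter.1 hz).2).neg_one_pow]
    simp [s, Finset.filter_filter, ← hcard]
  have rank_lt : ∀ z ∈ s, grade ℕ z - grade ℕ x ∈ Finset.range (r + 1) := by
    intro z hz
    have := grade_mono (𝕆 := ℕ) (Finset.mem_filter.1 hz).2.2
    rw [Finset.mem_range]
    omega
  have filter_eq (i : ℕ) : {z ∈ s | grade ℕ z - grade ℕ x = i} = level x y i := by
    ext z
    simp only [s, Finset.mem_filter, Finset.mem_univ, true_and, Set.mem_Icc, mem_level, and_assoc]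
    refine and_congr_right fun hxz => and_congr_right fun _ => ?_
    have := grade_mono (𝕆 := ℕ) hxz
    omega
  have sum_level (i : ℕ) : ∑ z ∈ level x y i, (-1 : ℤ) ^ grade ℕ z =
      (-1) ^ grade ℕ x * ((-1) ^ i * (level x y i).card) := by
    rw [Finset.sum_congr rfl fun z hz => by rw [(mem_level.1 hz).2.2], Finset.sum_const,
      nsmul_eq_mul, pow_add]
    ring
  simp only [← Finset.sum_fiberwise_of_maps_to rank_lt, filter_eq, sum_level, ← Finset.mul_sum]
    at sum_eq_zero
  exact (mul_eq_zero.1 sum_eq_zero).resolve_left (pow_ne_zero _ (by norm_num))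

section CoverRegular

variable {P : Type*} [PartialOrder P] [Fintype P] [GradeOrder ℕ P] {x y : P} {r i : ℕ}

variable (P) in
/-- Every interval of rank `r > 0` has `A r` atoms and `A r` coatoms; `A` is the atom function of
a binomial poset. -/
structure IsCoverRegular (A : ℕ → ℕ) : Prop where
  card_intervalAtoms : ∀ {x y : P}, x < y →
    (intervalAtoms x y).card = A (grade ℕ y - grade ℕ x)
  card_intervalCoatoms : ∀ {x y : P}, x < y →
    (intervalCoatoms x y).card = A (grade ℕ y - grade ℕ x)

theorem IsBinomial.exists_isCoverRegular [BoundedOrder P] (hB : IsBinomial P) :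
    ∃ A, IsCoverRegular P A := by
  classical
  have exists_count (r : ℕ) : ∃ B, 0 < B ∧
      ∀ x y : P, x ≤ y → grade ℕ y - grade ℕ x = r → numMaxChains x y = B := by
    by_cases hr : ∃ u v : P, u ≤ v ∧ grade ℕ v - grade ℕ u = r
    · obtain ⟨u, v, huv, rfl⟩ := hr
      exact ⟨numMaxChains u v, numMaxChains_pos u v, fun x y hxy hr =>
        hB.numMaxChains_eq _ x y u v hxy huv (hr ▸ hasRank_Icc hxy) (hasRank_Icc huv)⟩
    · push Not at hr
      exact ⟨1, one_pos, fun x y hxy hr' => absurd hr' (hr x y hxy)⟩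
  choose B hB_pos numMaxChains_eq using exists_count
  refine ⟨fun r => B r / B (r - 1), fun {x y} hxy => ?_, fun {x y} hxy => ?_⟩
  · have hmul := numMaxChains_eq_card_covers_mul hxy fun a hxa hay =>
      numMaxChains_eq (grade ℕ y - grade ℕ x - 1) a y hay
        (by rw [grade_eq_succ_of_covBy hxa]; omega)
    rw [numMaxChains_eq _ x y hxy.le rfl] at hmul
    rw [hmul, Nat.mul_div_cancel _ (hB_pos _), Nat.card_eq_fintype_card, Fintype.card_subtype]
    rfl
  · have hmul := numMaxChains_eq_card_cocovers_mul hxy fun b hxb hby =>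
      numMaxChains_eq (grade ℕ y - grade ℕ x - 1) x b hxb
        (by rw [grade_eq_succ_of_covBy hby]; omega)
    rw [numMaxChains_eq _ x y hxy.le rfl] at hmul
    rw [hmul, Nat.mul_div_cancel _ (hB_pos _), Nat.card_eq_fintype_card, Fintype.card_subtype]
    rfl

namespace IsCoverRegular

variable {A : ℕ → ℕ} (h : IsCoverRegular P A)
include h

theorem atomFunction_one (hxy : x < y) : A 1 = 1 := by
  obtain ⟨a, hxa, -⟩ := exists_covBy_le_of_lt hxy
  have hatoms : intervalAtoms x a = {a} := by
    ext b
    simp only [mem_intervalAtoms, Finset.mem_singleton]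
    constructor
    · exact fun hb => hb.2.eq_of_not_lt (hxa.2 hb.1.lt)
    · rintro rfl
      exact ⟨hxa, le_rfl⟩
  have := h.card_intervalAtoms hxa.lt
  rwa [hatoms, Finset.card_singleton, grade_eq_succ_of_covBy hxa, Nat.add_sub_cancel_left,
    eq_comm] at this

theorem atomFunction_le_succ (hr0 : 0 < r) (hxy : x < y) (hr : grade ℕ y = grade ℕ x + (r + 1)) :
    A r ≤ A (r + 1) := by
  obtain ⟨b, hxb, hby⟩ := exists_le_covBy_of_lt hxy
  have hb := grade_eq_succ_of_covBy hby
  have hlt : x < b := lt_of_le_of_grade_lt hxb (by omega)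
  have := Finset.card_le_card (intervalAtoms_mono (x := x) hby.le)
  rwa [h.card_intervalAtoms hlt, h.card_intervalAtoms hxy, show grade ℕ b - grade ℕ x = r by omega,
    Nat.sub_eq_of_eq_add' hr] at this

theorem card_level_mul (hr : grade ℕ y = grade ℕ x + r) (hi : i < r) :
    (level x y i).card * A (r - i) = (level x y (i + 1)).card * A (i + 1) := by
  classical
  refine Finset.card_mul_eq_card_mul (r := fun a b => a ⋖ b) (fun a ha => ?_) (fun b hb => ?_)
  · obtain ⟨hxa, hay, ha⟩ := mem_level.1 ha
    rw [show r - i = grade ℕ y - grade ℕ a by omega,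
      ← h.card_intervalAtoms (lt_of_le_of_grade_lt hay (by omega))]
    congr 1
    ext b
    simp only [Finset.mem_bipartiteAbove, mem_level, mem_intervalAtoms]
    constructor
    · rintro ⟨⟨-, hby, -⟩, hab⟩
      exact ⟨hab, hby⟩
    · rintro ⟨hab, hby⟩
      exact ⟨⟨hxa.trans hab.le, hby, by rw [grade_eq_succ_of_covBy hab, ha, add_assoc]⟩, hab⟩
  · obtain ⟨hxb, hby, hb⟩ := mem_level.1 hb
    rw [show i + 1 = grade ℕ b - grade ℕ x by omega,
      ← h.card_intervalCoatoms (lt_of_le_of_grade_lt hxb (by omega))]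
    congr 1
    ext a
    simp only [Finset.mem_bipartiteBelow, mem_level, mem_intervalCoatoms]
    constructor
    · rintro ⟨⟨hxa, -, -⟩, hab⟩
      exact ⟨hxa, hab⟩
    · rintro ⟨hxa, hab⟩
      have := grade_eq_succ_of_covBy hab
      exact ⟨⟨hxa, hab.le.trans hby, by omega⟩, hab⟩

end IsCoverRegular

end CoverRegular

section AtomFunction

/-- `L 0, …, L r` behave like the level sizes of an Eulerian interval of rank `r` in a binomial
poset with atom function `A`: the cover relations between consecutive levels are counted from
below and from above, and the Euler relation holds. -/
structure IsEulerProfile (A : ℕ → ℕ) (r : ℕ) (L : ℕ → ℕ) : Prop where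
  zero : L 0 = 1
  last : L r = 1
  mul_eq : ∀ i < r, L i * A (r - i) = L (i + 1) * A (i + 1)
  alternating_sum : ∑ i ∈ Finset.range (r + 1), (-1 : ℤ) ^ i * L i = 0

theorem isEulerProfile_choose {r : ℕ} (hr : r ≠ 0) : IsEulerProfile id r r.choose where
  zero := r.choose_zero_right
  last := r.choose_self
  mul_eq i _ := (r.choose_succ_right_eq i).symm
  alternating_sum := Int.alternating_sum_range_choose_of_ne hr

theorem isEulerProfile_butterfly {r : ℕ} (hr : Even r) (hr0 : r ≠ 0) :
    IsEulerProfile (fun i => if i = 1 then 1 else 2) r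
      (fun i => if i = 0 ∨ i = r then 1 else 2) := by
  obtain ⟨s, rfl⟩ : ∃ s, r = s + 1 := Nat.exists_eq_succ_of_ne_zero hr0
  have hs : ¬ Even s := Nat.even_add_one.1 hr
  refine ⟨by simp, by simp, fun i hi => ?_, ?_⟩
  · have hs0 : s ≠ 0 := by rintro rfl; exact hs Even.zero
    grind
  · have sum_inner : ∑ i ∈ Finset.range s, (-1 : ℤ) ^ (i + 1) *
        ((if i + 1 = 0 ∨ i + 1 = s + 1 then 1 else 2 : ℕ) : ℤ) = -2 := by
      calc _ = ∑ i ∈ Finset.range s, (-1 : ℤ) ^ i * -2 := Finset.sum_congr rfl fun i hi => by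
            rw [if_neg (by have := Finset.mem_range.1 hi; omega)]
            push_cast
            ring
        _ = -2 := by rw [← Finset.sum_mul, neg_one_geom_sum, if_neg hs, one_mul]
    rw [Finset.sum_range_succ, Finset.sum_range_succ', sum_inner]
    simp [hr.neg_one_pow]

namespace IsEulerProfile

variable {A a L l : ℕ → ℕ} {r : ℕ}

theorem apply_one (hL : IsEulerProfile A r L) (h1 : A 1 = 1) (hr : 0 < r) : L 1 = A r := by
  simpa [hL.zero, h1] using (hL.mul_eq 0 hr).symm

theorem apply_pred (hL : IsEulerProfile A r L) (h1 : A 1 = 1) (hr : 0 < r) : L (r - 1) = A r := by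
  simpa [hL.last, h1, Nat.sub_add_cancel hr, Nat.sub_sub_self hr]
    using hL.mul_eq (r - 1) (Nat.sub_one_lt_of_lt hr)

theorem sum_Ico_eq (hL : IsEulerProfile A r L) (h1 : A 1 = 1) (hr : Even r) (hr4 : 4 ≤ r) :
    ∑ i ∈ Finset.Ico 2 (r - 1), (-1 : ℤ) ^ i * L i = 2 * (A r - 1) := by
  have hL1 := hL.apply_one h1 (by omega)
  have hLpred := hL.apply_pred h1 (by omega)
  have hodd : Odd (r - 1) := Nat.Even.sub_odd (by omega) hr odd_one
  have hsum := hL.alternating_sum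
  rw [Finset.range_eq_Ico, Finset.sum_Ico_succ_top (Nat.zero_le r),
    show r = r - 1 + 1 by omega, Finset.sum_Ico_succ_top (Nat.zero_le _), Nat.sub_add_cancel,
    Finset.sum_eq_sum_Ico_succ_bot (by omega), Finset.sum_eq_sum_Ico_succ_bot (by omega), hL.zero,
    hL.last, zero_add, hL1, hLpred, hr.neg_one_pow, hodd.neg_one_pow] at hsum
  · push_cast at hsum
    linarith
  · omega

/-- Both profiles satisfy the same recursion in the middle levels, so there they are proportional,
and the Euler relations compare the outer levels. -/
theorem compare (hL : IsEulerProfile A r L) (hl : IsEulerProfile a r l) (hr : Even r) (hr4 : 4 ≤ r)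
    (hA1 : A 1 = 1) (ha1 : a 1 = 1) (hAa : ∀ i, 2 ≤ i → i ≤ r - 2 → A i = a i ∧ 0 < a i) :
    ((A r : ℤ) - 1) * (a r * a (r - 1)) = (a r - 1) * (A r * A (r - 1)) := by
  have proportional : ∀ i, 2 ≤ i → i ≤ r - 2 →
      a r * a (r - 1) * L i = A r * A (r - 1) * l i := by
    intro i hi
    induction i, hi using Nat.le_induction with
    | base =>
      intro h2
      obtain ⟨hA2, ha2⟩ := hAa 2 le_rfl h2
      have hL2 := hL.mul_eq 1 (by omega)
      have hl2 := hl.mul_eq 1 (by omega)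
      rw [hL.apply_one hA1 (by omega), hA2] at hL2
      rw [hl.apply_one ha1 (by omega)] at hl2
      refine Nat.eq_of_mul_eq_mul_right ha2 ?_
      rw [hL2, hl2]
      ring
    | succ i hi ih =>
      intro hir
      obtain ⟨hAi, hai⟩ := hAa (i + 1) (by omega) hir
      refine Nat.eq_of_mul_eq_mul_right hai ?_
      rw [mul_assoc, mul_assoc (A r * A (r - 1)), ← hl.mul_eq i (by omega), ← hAi,
        ← hL.mul_eq i (by omega), (hAa (r - i) (by omega) (by omega)).1, ← mul_assoc, ← mul_assoc,
        ih (by omega)]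
  have sum_eq : ((a r * a (r - 1) : ℕ) : ℤ) * ∑ i ∈ Finset.Ico 2 (r - 1), (-1 : ℤ) ^ i * L i =
      ((A r * A (r - 1) : ℕ) : ℤ) * ∑ i ∈ Finset.Ico 2 (r - 1), (-1 : ℤ) ^ i * l i := by
    rw [Finset.mul_sum, Finset.mul_sum]
    refine Finset.sum_congr rfl fun i hi => ?_
    rw [Finset.mem_Ico] at hi
    rw [mul_left_comm, mul_left_comm _ _ (l i : ℤ), ← Nat.cast_mul, ← Nat.cast_mul,
      proportional i hi.1 (by omega)]
  rw [hL.sum_Ico_eq hA1 hr hr4, hl.sum_Ico_eq ha1 hr hr4] at sum_eq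
  push_cast at sum_eq
  linarith

theorem mul_sub_pred_eq_of_boolean (hL : IsEulerProfile A r L) (hr : Even r) (hr4 : 4 ≤ r)
    (hA1 : A 1 = 1) (hA : ∀ i, 2 ≤ i → i ≤ r - 2 → A i = i) :
    (A r : ℤ) * (r - A (r - 1)) = r := by
  have hcompare := hL.compare (isEulerProfile_choose (by omega)) hr hr4 hA1 rfl
    fun i hi hir => ⟨hA i hi hir, two_pos.trans_le hi⟩
  simp only [id] at hcompare
  rw [Nat.cast_sub (by omega), Nat.cast_one] at hcompare
  have hr0 : (r : ℤ) - 1 ≠ 0 := by omega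
  refine mul_right_cancel₀ hr0 ?_
  linear_combination hcompare

theorem mul_sub_pred_eq_of_butterfly (hL : IsEulerProfile A r L) (hr : Even r) (hr4 : 4 ≤ r)
    (hA1 : A 1 = 1) (hA : ∀ i, 2 ≤ i → i ≤ r - 2 → A i = 2) :
    (A r : ℤ) * (4 - A (r - 1)) = 4 := by
  have hcompare := hL.compare (isEulerProfile_butterfly hr (by omega)) hr hr4 hA1 rfl
    fun i hi hir => by rw [hA i hi hir, if_neg (by omega)]; decide
  rw [if_neg (by omega), if_neg (by omega)] at hcompare
  push_cast at hcompare
  linear_combination hcompare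

theorem eq_of_boolean (hL : IsEulerProfile A r L) (hr : Even r) (hr6 : 6 ≤ r) (hA1 : A 1 = 1)
    (hA : ∀ i, 2 ≤ i → i ≤ r - 2 → A i = i) (hle : A (r - 2) ≤ A (r - 1))
    (hle' : A (r - 1) ≤ A r) : A (r - 1) = r - 1 ∧ A r = r := by
  have hmul := hL.mul_sub_pred_eq_of_boolean hr (by omega) hA1 hA
  rw [hA (r - 2) (by omega) le_rfl] at hle
  have hlt : A (r - 1) < r := by
    zify
    by_contra! hge
    nlinarith
  obtain hpred | hpred : A (r - 1) = r - 2 ∨ A (r - 1) = r - 1 := by omega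
  · have : (r : ℤ) - A (r - 1) = 2 := by omega
    rw [this] at hmul
    omega
  · have : (r : ℤ) - A (r - 1) = 1 := by omega
    rw [this] at hmul
    omega

theorem eq_two_of_butterfly (hL : IsEulerProfile A r L) (hr : Even r) (hr4 : 4 ≤ r) (hA1 : A 1 = 1)
    (hA : ∀ i, 2 ≤ i → i ≤ r - 2 → A i = 2) (hle : 2 ≤ A (r - 1)) (h3 : A (r - 1) ≠ 3) :
    A (r - 1) = 2 ∧ A r = 2 := by
  have hmul := hL.mul_sub_pred_eq_of_butterfly hr hr4 hA1 hA
  have hlt : A (r - 1) < 4 := by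
    zify
    by_contra! hge
    nlinarith
  have hpred : A (r - 1) = 2 := by omega
  rw [hpred] at hmul
  omega

theorem apply_two (hL : IsEulerProfile A 2 L) (hA1 : A 1 = 1) : A 2 = 2 := by
  have hsum := hL.alternating_sum
  simp only [Finset.sum_range_succ, Finset.sum_range_zero, hL.zero, hL.last,
    hL.apply_one hA1 two_pos] at hsum
  push_cast at hsum
  omega

theorem apply_three_four (hL : IsEulerProfile A 4 L) (hA1 : A 1 = 1) (hA2 : A 2 = 2)
    (hle : A 2 ≤ A 3) : (A 3 = 3 ∧ A 4 = 4) ∨ (A 3 = 2 ∧ A 4 = 2) := by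
  have hA : ∀ i, 2 ≤ i → i ≤ 4 - 2 → A i = 2 := fun i hi hi' => by
    obtain rfl : i = 2 := by omega
    exact hA2
  by_cases h3 : A 3 = 3
  · have hmul := hL.mul_sub_pred_eq_of_butterfly (by decide) le_rfl hA1 hA
    norm_num [h3] at hmul
    exact Or.inl ⟨h3, by omega⟩
  · exact Or.inr (hL.eq_two_of_butterfly (by decide) le_rfl hA1 hA (hA2 ▸ hle) h3)

end IsEulerProfile

end AtomFunction

section ButterflyAtoms

variable {P : Type*} [PartialOrder P] [Fintype P] [GradeOrder ℕ P] {A : ℕ → ℕ} {x y z w a : P}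
  {N : ℕ}

namespace IsCoverRegular

variable (h : IsCoverRegular P A) (hA : ∀ i, 2 ≤ i → i ≤ N → A i = 2)
include h hA

theorem intervalAtoms_eq_of_le_of_butterfly (hxz : x ≤ z) (hzw : z ≤ w)
    (hz : grade ℕ x + 2 ≤ grade ℕ z) (hw : grade ℕ w ≤ grade ℕ x + N) :
    intervalAtoms x z = intervalAtoms x w := by
  have := grade_mono (𝕆 := ℕ) hzw
  have hlt : x < z := lt_of_le_of_grade_lt hxz (by omega)
  refine Finset.eq_of_subset_of_card_le (intervalAtoms_mono hzw) ?_
  rw [h.card_intervalAtoms hlt, h.card_intervalAtoms (hlt.trans_le hzw),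
    hA _ (by omega) (by omega), hA _ (by omega) (by omega)]

/-- All covers of the common atom `a` lie below every element of rank two of `[a, y]`. -/
theorem intervalAtoms_eq_of_mem_of_butterfly (hN : 3 ≤ N) (hy : grade ℕ y = grade ℕ x + (N + 1))
    (hzy : z < y) (hwy : w < y) (hz : grade ℕ x + 2 ≤ grade ℕ z) (hw : grade ℕ x + 2 ≤ grade ℕ w)
    (haz : a ∈ intervalAtoms x z) (haw : a ∈ intervalAtoms x w) :
    intervalAtoms x z = intervalAtoms x w := by
  rw [mem_intervalAtoms] at haz haw
  have ha := grade_eq_succ_of_covBy haz.1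
  obtain ⟨g, ⟨hag, hgy⟩, hg⟩ := exists_mem_Icc_grade_eq (haz.2.trans hzy.le)
    (i := grade ℕ a + 2) (by omega) (by omega)
  have covers_le {v : P} (hav : a ≤ v) (hvy : v < y) (hv : grade ℕ x + 2 ≤ grade ℕ v) :
      intervalAtoms x v = intervalAtoms x g := by
    obtain ⟨e, hae, hev⟩ := exists_covBy_le_of_lt (lt_of_le_of_grade_lt hav (by omega))
    have he := grade_eq_succ_of_covBy hae
    have hxe : x ≤ e := haz.1.le.trans hae.le
    have := grade_strictMono (𝕆 := ℕ) hvy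
    have heg : e ≤ g := by
      have hmem : e ∈ intervalAtoms a y := mem_intervalAtoms.2 ⟨hae, hev.trans hvy.le⟩
      rw [← h.intervalAtoms_eq_of_le_of_butterfly hA hag hgy hg.ge (by omega)] at hmem
      exact (mem_intervalAtoms.1 hmem).2
    exact (h.intervalAtoms_eq_of_le_of_butterfly hA hxe hev (by omega) (by omega)).symm.trans
      (h.intervalAtoms_eq_of_le_of_butterfly hA hxe heg (by omega) (by omega))
  exact (covers_le haz.2 hzy hz).trans (covers_le haw.2 hwy hw).symm

theorem atomFunction_succ_ne_three (hN : 3 ≤ N) (hxy : x < y)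
    (hy : grade ℕ y = grade ℕ x + (N + 1)) : A (N + 1) ≠ 3 := by
  classical
  intro hA3
  have card_atoms : (intervalAtoms x y).card = 3 := by
    rw [h.card_intervalAtoms hxy, Nat.sub_eq_of_eq_add' hy, hA3]
  have card_rank_two {e : P} (hxe : x ≤ e) (he : grade ℕ e = grade ℕ x + 2) :
      (intervalAtoms x e).card = 2 := by
    rw [h.card_intervalAtoms (lt_of_le_of_grade_lt hxe (by omega)), Nat.sub_eq_of_eq_add' he,
      hA 2 le_rfl (by omega)]
  obtain ⟨e, ⟨hxe, hey⟩, he⟩ :=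
    exists_mem_Icc_grade_eq hxy.le (i := grade ℕ x + 2) (by omega) (by omega)
  obtain ⟨c, hcy, hce⟩ := Finset.exists_mem_notMem_of_card_lt_card
    (s := intervalAtoms x e) (t := intervalAtoms x y)
    (by rw [card_rank_two hxe he, card_atoms]; omega)
  rw [mem_intervalAtoms] at hcy
  have hc := grade_eq_succ_of_covBy hcy.1
  obtain ⟨f, hcf, hfy⟩ := exists_covBy_le_of_lt (lt_of_le_of_grade_lt hcy.2 (by omega))
  have hf := grade_eq_succ_of_covBy hcf
  obtain ⟨a, ha⟩ := Finset.inter_nonempty_of_card_lt_card_add_card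
    (intervalAtoms_mono (x := x) hey) (intervalAtoms_mono (x := x) hfy)
    (by rw [card_atoms, card_rank_two hxe he, card_rank_two (hcy.1.le.trans hcf.le) (by omega)]
        omega)
  rw [Finset.mem_inter] at ha
  refine hce ?_
  rw [h.intervalAtoms_eq_of_mem_of_butterfly hA hN hy (lt_of_le_of_grade_lt hey (by omega))
    (lt_of_le_of_grade_lt hfy (by omega)) he.ge (by omega) ha.1 ha.2]
  exact mem_intervalAtoms.2 ⟨hcy.1, hcf.le⟩

theorem card_level_of_butterfly {u v : P} {r i : ℕ} (hr : grade ℕ v = grade ℕ u + r) (huv : u < v)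
    (hrN : r ≤ N) (hi0 : 0 < i) (hir : i < r) : (level u v i).card = 2 := by
  induction i, Nat.succ_le_of_lt hi0 using Nat.le_induction with
  | base =>
    have := h.card_level_mul hr (i := 0) (by omega)
    rwa [level_zero huv.le, Finset.card_singleton, one_mul, hA _ (by omega) (by omega),
      h.atomFunction_one huv, mul_one, eq_comm] at this
  | succ i hi ih =>
    have := h.card_level_mul hr (i := i) (by omega)
    rw [ih (by omega) (by omega), hA _ (by omega) (by omega), hA _ (by omega) (by omega)] at this
    omega

theorem le_of_grade_lt_of_butterfly {u v : P} (hv : grade ℕ v ≤ grade ℕ u + N)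
    (hz : z ∈ Set.Icc u v) (hw : w ∈ Set.Icc u v) (hzw : grade ℕ z < grade ℕ w) : z ≤ w := by
  have huz := grade_mono (𝕆 := ℕ) hz.1
  have hwv := grade_mono (𝕆 := ℕ) hw.2
  obtain ⟨i, hi⟩ := Nat.exists_eq_add_of_le huz
  obtain rfl | hi0 := i.eq_zero_or_pos
  · exact (eq_of_le_of_grade_le hz.1 hi.le).symm.trans_le hw.1
  obtain ⟨r, hr⟩ := Nat.exists_eq_add_of_le (huz.trans hzw.le)
  obtain ⟨s, hs⟩ := Nat.exists_eq_add_of_le (huz.trans (hzw.le.trans hwv))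
  have huw : u < w := lt_of_le_of_grade_lt hw.1 (by omega)
  have hlevel : level u w i = level u v i := Finset.eq_of_subset_of_card_le
    (fun x hx => mem_level.2 ((mem_level.1 hx).imp_right fun hx => hx.imp_left hw.2.trans')) <| by
    rw [h.card_level_of_butterfly hA hr huw (by omega) hi0 (by omega),
      h.card_level_of_butterfly hA hs (huw.trans_le hw.2) (by omega) hi0 (by omega)]
  have hzmem : z ∈ level u w i := hlevel ▸ mem_level.2 ⟨hz.1, hz.2, hi⟩
  exact (mem_level.1 hzmem).2.1

end IsCoverRegular

end ButterflyAtoms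

section Dichotomy

variable {P : Type*} [PartialOrder P] [BoundedOrder P] [Fintype P] [GradeMinOrder ℕ P]
  {A : ℕ → ℕ} {x y : P} {r j : ℕ}

namespace IsCoverRegular

theorem isEulerProfile (h : IsCoverRegular P A) (hE : IsEulerian P) (hxy : x < y)
    (hr : grade ℕ y = grade ℕ x + r) : IsEulerProfile A r fun i => (level x y i).card where
  zero := by rw [level_zero hxy.le, Finset.card_singleton]
  last := by rw [level_self hxy.le hr, Finset.card_singleton]
  mul_eq _ hi := h.card_level_mul hr hi
  alternating_sum := hE.sum_card_level hxy hr

theorem exists_isEulerProfile (h : IsCoverRegular P A) (hE : IsEulerian P) (hr0 : 0 < r)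
    (hr : r ≤ grade ℕ (⊤ : P)) : ∃ L, IsEulerProfile A r L := by
  obtain ⟨w, hw, hwr⟩ := exists_bot_lt_grade_eq hr0 hr
  exact ⟨_, h.isEulerProfile hE hw hwr⟩

theorem atomFunction_dichotomy (h : IsCoverRegular P A) (hE : IsEulerian P) (hj : 2 ≤ j)
    (hjP : 2 * j ≤ grade ℕ (⊤ : P)) :
    (∀ i, 1 ≤ i → i ≤ 2 * j → A i = i) ∨ (∀ i, 2 ≤ i → i ≤ 2 * j → A i = 2) := by
  have mono {r : ℕ} (hr0 : 0 < r) (hr : r + 1 ≤ grade ℕ (⊤ : P)) : A r ≤ A (r + 1) := by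
    obtain ⟨w, hw, hwr⟩ := exists_bot_lt_grade_eq r.succ_pos hr
    exact h.atomFunction_le_succ hr0 hw hwr
  have hA1 : A 1 = 1 := by
    obtain ⟨w, hw, -⟩ := exists_bot_lt_grade_eq (P := P) one_pos (by omega)
    exact h.atomFunction_one hw
  have hA2 : A 2 = 2 := by
    obtain ⟨L, hL⟩ := h.exists_isEulerProfile hE two_pos (by omega)
    exact hL.apply_two hA1
  induction j, hj using Nat.le_induction with
  | base =>
    obtain ⟨L, hL⟩ := h.exists_isEulerProfile hE four_pos hjP
    refine (hL.apply_three_four hA1 hA2 (mono two_pos (by omega))).imp ?_ ?_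
    all_goals
      rintro ⟨h3, h4⟩ i hi hi'
      interval_cases i <;> assumption
  | succ j hj ih =>
    have hr : 2 * (j + 1) - 1 = 2 * j + 1 := by omega
    obtain ⟨L, hL⟩ := h.exists_isEulerProfile hE (r := 2 * (j + 1)) (by omega) hjP
    refine (ih (by omega)).imp (fun hA => ?_) (fun hA => ?_)
    · obtain ⟨hpred, hlast⟩ := hL.eq_of_boolean (even_two_mul _) (by omega) hA1
        (fun i hi => hA i (by omega)) (hr ▸ mono (by omega) (by omega))
        (hr ▸ mono (by omega) (by omega))
      intro i hi hi'
      obtain hi' | rfl | rfl : i ≤ 2 * j ∨ i = 2 * (j + 1) - 1 ∨ i = 2 * (j + 1) := by omega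
      exacts [hA i hi hi', hpred, hlast]
    · obtain ⟨w, hw, hwr⟩ := exists_bot_lt_grade_eq (P := P) (r := 2 * j + 1) (by omega) (by omega)
      obtain ⟨hpred, hlast⟩ := hL.eq_two_of_butterfly (even_two_mul _) (by omega) hA1 hA
        (hr ▸ (hA (2 * j) (by omega) le_rfl).ge.trans (mono (by omega) (by omega)))
        (hr ▸ h.atomFunction_succ_ne_three hA (by omega) hw hwr)
      intro i hi hi'
      obtain hi' | rfl | rfl : i ≤ 2 * j ∨ i = 2 * (j + 1) - 1 ∨ i = 2 * (j + 1) := by omega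
      exacts [hA i hi hi', hpred, hlast]

end IsCoverRegular

end Dichotomy

section BooleanIntervals

variable {P : Type*} [PartialOrder P] [Fintype P] [GradeOrder ℕ P] {u v z w a b c : P} {N : ℕ}
  {T : Finset P}

variable (P) in
/-- Intervals of rank `r ≤ N` have `r` atoms and `r` coatoms, like the Boolean lattice. -/
structure HasBooleanIntervals (N : ℕ) : Prop where
  card_intervalAtoms : ∀ {x y : P}, x ≤ y → grade ℕ y ≤ grade ℕ x + N →
    (intervalAtoms x y).card = grade ℕ y - grade ℕ x
  card_intervalCoatoms : ∀ {x y : P}, x ≤ y → grade ℕ y ≤ grade ℕ x + N →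
    (intervalCoatoms x y).card = grade ℕ y - grade ℕ x

theorem IsCoverRegular.hasBooleanIntervals {A : ℕ → ℕ} (h : IsCoverRegular P A)
    (hA : ∀ i, 1 ≤ i → i ≤ N → A i = i) : HasBooleanIntervals P N where
  card_intervalAtoms {x y} hxy hN := by
    rcases hxy.eq_or_lt with rfl | hlt
    · rw [Nat.sub_self, Finset.card_eq_zero, Finset.eq_empty_iff_forall_notMem]
      exact fun a ha => (mem_intervalAtoms.1 ha).1.lt.not_ge (mem_intervalAtoms.1 ha).2
    · have := grade_strictMono (𝕆 := ℕ) hlt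
      rw [h.card_intervalAtoms hlt, hA _ (by omega) (by omega)]
  card_intervalCoatoms {x y} hxy hN := by
    rcases hxy.eq_or_lt with rfl | hlt
    · rw [Nat.sub_self, Finset.card_eq_zero, Finset.eq_empty_iff_forall_notMem]
      exact fun a ha => (mem_intervalCoatoms.1 ha).2.lt.not_ge (mem_intervalCoatoms.1 ha).1
    · have := grade_strictMono (𝕆 := ℕ) hlt
      rw [h.card_intervalCoatoms hlt, hA _ (by omega) (by omega)]

namespace HasBooleanIntervals

variable (h : HasBooleanIntervals P N)
include h

theorem card_intervalCoatoms_sdiff [DecidableEq P] (hN : grade ℕ v ≤ grade ℕ u + N) (huz : u ≤ z)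
    (hzv : z ≤ v) :
    (intervalCoatoms u v \ intervalCoatoms z v).card = grade ℕ z - grade ℕ u := by
  have hsub : intervalCoatoms z v ⊆ intervalCoatoms u v := fun c hc =>
    mem_intervalCoatoms.2 ((mem_intervalCoatoms.1 hc).imp_left huz.trans)
  have := grade_mono (𝕆 := ℕ) huz
  have := grade_mono (𝕆 := ℕ) hzv
  rw [Finset.card_sdiff_of_subset hsub, h.card_intervalCoatoms (huz.trans hzv) hN,
    h.card_intervalCoatoms hzv (by omega)]
  omega

theorem exists_coatom_not_le (hN : grade ℕ v ≤ grade ℕ u + N) (ha : a ∈ intervalAtoms u v) :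
    ∃ c ∈ intervalCoatoms u v, ¬ a ≤ c := by
  classical
  rw [mem_intervalAtoms] at ha
  have hcard := h.card_intervalCoatoms_sdiff hN ha.1.le ha.2
  rw [grade_eq_succ_of_covBy ha.1, Nat.add_sub_cancel_left] at hcard
  obtain ⟨c, hc⟩ := Finset.card_pos.1 (hcard ▸ one_pos)
  simp only [Finset.mem_sdiff, mem_intervalCoatoms, not_and_or] at hc
  exact ⟨c, mem_intervalCoatoms.2 hc.1, hc.2.resolve_right (not_not.2 hc.1.2)⟩

/-- A coatom `c` lies above all but one of the atoms, so it is determined by any atom it misses. -/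
theorem le_of_ne_of_not_le (hN : grade ℕ v ≤ grade ℕ u + N) (hc : c ∈ intervalCoatoms u v)
    (ha : a ∈ intervalAtoms u v) (hac : ¬ a ≤ c) (hb : b ∈ intervalAtoms u v) (hba : b ≠ a) :
    b ≤ c := by
  classical
  rw [mem_intervalCoatoms] at hc
  have := grade_eq_succ_of_covBy hc.2
  have hsub : intervalAtoms u c ⊆ (intervalAtoms u v).erase a := fun d hd =>
    Finset.mem_erase.2 ⟨by rintro rfl; exact hac (mem_intervalAtoms.1 hd).2,
      intervalAtoms_mono hc.2.le hd⟩
  have heq := Finset.eq_of_subset_of_card_le hsub <| by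
    rw [Finset.card_erase_of_mem ha, h.card_intervalAtoms (hc.1.trans hc.2.le) hN,
      h.card_intervalAtoms hc.1 (by omega)]
    omega
  have hbc : b ∈ intervalAtoms u c := heq ▸ Finset.mem_erase.2 ⟨hba, hb⟩
  exact (mem_intervalAtoms.1 hbc).2

/-- The coatoms missed by the atoms of `z` are distinct, and as many as the coatoms that do not
lie above `z`. -/
theorem le_coatom_of_intervalAtoms_subset (hN : grade ℕ v ≤ grade ℕ u + N)
    (hc : c ∈ intervalCoatoms u v) (huz : u ≤ z) (hzv : z ≤ v)
    (hzc : intervalAtoms u z ⊆ intervalAtoms u c) : z ≤ c := by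
  classical
  by_contra hnle
  have hatoms {b : P} (hb : b ∈ intervalAtoms u z) : b ∈ intervalAtoms u v :=
    intervalAtoms_mono hzv hb
  choose! f hf hbf using fun b hb => h.exists_coatom_not_le hN (hatoms (b := b) hb)
  have hcM : c ∈ intervalCoatoms u v \ intervalCoatoms z v :=
    Finset.mem_sdiff.2 ⟨hc, fun hc' => hnle (mem_intervalCoatoms.1 hc').1⟩
  have maps : Set.MapsTo f (intervalAtoms u z)
      ((intervalCoatoms u v \ intervalCoatoms z v).erase c) := fun b hb => by
    refine Finset.mem_erase.2 ⟨?_, Finset.mem_sdiff.2 ⟨hf b hb, fun hfb => ?_⟩⟩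
    · intro hfb
      exact hbf b hb (hfb ▸ (mem_intervalAtoms.1 (hzc hb)).2)
    · exact hbf b hb ((mem_intervalAtoms.1 hb).2.trans (mem_intervalCoatoms.1 hfb).1)
  have inj : Set.InjOn f (intervalAtoms u z) := fun b hb d hd hbd => by
    by_contra hne
    exact hbf b hb (hbd ▸ h.le_of_ne_of_not_le hN (hf d hd) (hatoms hd) (hbf d hd) (hatoms hb) hne)
  have hle := Finset.card_le_card_of_injOn f maps inj
  have hpos := Finset.card_pos.2 ⟨c, hcM⟩
  have := grade_mono (𝕆 := ℕ) hzv
  rw [Finset.card_erase_of_mem hcM, h.card_intervalCoatoms_sdiff hN huz hzv,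
    h.card_intervalAtoms huz (by omega)] at hle
  rw [h.card_intervalCoatoms_sdiff hN huz hzv] at hpos
  omega

theorem le_of_intervalAtoms_subset (hN : grade ℕ v ≤ grade ℕ u + N) (hz : z ∈ Set.Icc u v)
    (hw : w ∈ Set.Icc u v) (hzw : intervalAtoms u z ⊆ intervalAtoms u w) : z ≤ w := by
  induction v using WellFoundedLT.induction with
  | ind v ih =>
    rcases hw.2.eq_or_lt with rfl | hlt
    · exact hz.2
    · obtain ⟨c, hwc, hcv⟩ := exists_le_covBy_of_lt hlt
      have := grade_eq_succ_of_covBy hcv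
      have hzc : z ≤ c := h.le_coatom_of_intervalAtoms_subset hN
        (mem_intervalCoatoms.2 ⟨hw.1.trans hwc, hcv⟩) hz.1 hz.2
        (hzw.trans (intervalAtoms_mono hwc))
      exact ih c hcv.lt (by omega) ⟨hz.1, hzc⟩ ⟨hw.1, hwc⟩

theorem exists_intervalAtoms_eq (hN : grade ℕ v ≤ grade ℕ u + N) (huv : u ≤ v)
    (hT : T ⊆ intervalAtoms u v) :
    ∃ z ∈ Set.Icc u v, intervalAtoms u z = T ∧ grade ℕ z = grade ℕ u + T.card := by
  induction v using WellFoundedLT.induction with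
  | ind v ih =>
    rcases hT.eq_or_ssubset with rfl | hssub
    · refine ⟨v, ⟨huv, le_rfl⟩, rfl, ?_⟩
      rw [h.card_intervalAtoms huv hN, Nat.add_sub_cancel' (grade_mono huv)]
    · obtain ⟨a, ha, haT⟩ := Finset.exists_of_ssubset hssub
      obtain ⟨c, hc, hac⟩ := h.exists_coatom_not_le hN ha
      have hTc : T ⊆ intervalAtoms u c := fun b hb => mem_intervalAtoms.2
        ⟨(mem_intervalAtoms.1 (hT hb)).1,
          h.le_of_ne_of_not_le hN hc ha hac (hT hb) (by rintro rfl; exact haT hb)⟩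
      rw [mem_intervalCoatoms] at hc
      have := grade_eq_succ_of_covBy hc.2
      obtain ⟨z, hz, hzT⟩ := ih c hc.2.lt (by omega) hc.1 hTc
      exact ⟨z, ⟨hz.1, hz.2.trans hc.2.le⟩, hzT⟩

end HasBooleanIntervals

end BooleanIntervals

section Summation

variable {P Q : Type*} [PartialOrder P] [PartialOrder Q] [BoundedOrder Q]

theorem exists_orderIso_kSum {ι : Type*} [Finite ι] [Nonempty ι] (φ : ι → Q → P)
    (hle : ∀ i j p q, φ i p ≤ φ j q ↔ p = ⊥ ∨ q = ⊤ ∨ (i = j ∧ p ≤ q))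
    (hsurj : ∀ x, ∃ i q, φ i q = x) : ∃ k : ℕ, 0 < k ∧ Nonempty (P ≃o KSum k Q) := by
  let e : Fin (Nat.card ι) ≃ ι := (Finite.equivFin ι).symm
  let f : Copies (Nat.card ι) Q → P := fun c => φ (e c.copy) c.elt
  have f_le_iff (c d) : f c ≤ f d ↔ c ≤ d := by
    rw [hle, e.injective.eq_iff]
    rfl
  let g : KSum (Nat.card ι) Q ↪o P := OrderEmbedding.ofMapLEIff
    (fun c => f (ofAntisymmetrization (· ≤ ·) c)) fun c d =>
      (f_le_iff _ _).trans ofAntisymmetrization_le_ofAntisymmetrization_iff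
  have g_surjective : Function.Surjective g := fun x => by
    obtain ⟨i, q, rfl⟩ := hsurj x
    obtain ⟨i, rfl⟩ := e.surjective i
    have hc : AntisymmRel (· ≤ ·) (ofAntisymmetrization (· ≤ ·)
        (toAntisymmetrization (· ≤ ·) (Copies.mk i q))) (Copies.mk i q) :=
      Quotient.exact (toAntisymmetrization_ofAntisymmetrization _ _)
    exact ⟨toAntisymmetrization (· ≤ ·) ⟨i, q⟩,
      ((f_le_iff _ _).2 hc.1).antisymm ((f_le_iff _ _).2 hc.2)⟩
  exact ⟨Nat.card ι, Nat.card_pos, ⟨(RelIso.ofSurjective g g_surjective).symm⟩⟩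

variable [BoundedOrder P] {a b z w : P}

/-- Two atoms are linked if they have a common upper bound other than `⊤`. -/
def Linked (a b : P) : Prop :=
  IsAtom a ∧ IsAtom b ∧ ∃ z < ⊤, a ≤ z ∧ b ≤ z

theorem Linked.symm (hab : Linked a b) : Linked b a :=
  let ⟨ha, hb, z, hz, haz, hbz⟩ := hab
  ⟨hb, ha, z, hz, hbz, haz⟩

theorem linked_self (ha : IsAtom a) (ha1 : a ≠ ⊤) : Linked a a :=
  ⟨ha, ha, a, ha1.lt_top, le_rfl, le_rfl⟩

/-- The elements above an atom linked to `a`, together with `⊥` and `⊤`: the summand of `P` that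
contains `a`, when linkage is transitive. -/
def component (a : P) : Set P :=
  {z | z = ⊥ ∨ z = ⊤ ∨ ∃ b ≤ z, Linked a b}

instance component.instBoundedOrder (a : P) : BoundedOrder (component a) where
  bot := ⟨⊥, Or.inl rfl⟩
  bot_le z := bot_le (a := z.1)
  top := ⟨⊤, Or.inr (Or.inl rfl)⟩
  le_top z := le_top (a := z.1)

theorem Linked.component_eq [IsTrans P Linked] (hab : Linked a b) : component a = component b := by
  ext z
  exact or_congr_right <| or_congr_right <| exists_congr fun c => and_congr_right fun _ =>
    ⟨_root_.trans hab.symm, _root_.trans hab⟩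

theorem component_eq_of_le [IsTrans P Linked] (hz : z ∈ component a) (hw : w ∈ component b)
    (hz0 : z ≠ ⊥) (hw1 : w ≠ ⊤) (hzw : z ≤ w) : component a = component b := by
  obtain ⟨c, hcz, hac⟩ := (hz.resolve_left hz0).resolve_left (ne_top_of_le_ne_top hw1 hzw)
  obtain ⟨d, hdw, hbd⟩ := (hw.resolve_left (ne_bot_of_le_ne_bot hz0 hzw)).resolve_left hw1
  have hcd : Linked c d := ⟨hac.2.1, hbd.2.1, w, hw1.lt_top, hcz.trans hzw, hdw⟩
  exact (hac.component_eq.trans hcd.component_eq).trans hbd.component_eq.symm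

theorem exists_mem_component [IsAtomic P] [Nontrivial P] (z : P) :
    ∃ a, IsAtom a ∧ z ∈ component a := by
  rcases eq_or_ne z ⊥ with rfl | hz0
  · obtain ⟨a, ha, -⟩ := (eq_bot_or_exists_atom_le (⊤ : P)).resolve_left top_ne_bot
    exact ⟨a, ha, Or.inl rfl⟩
  · obtain ⟨a, ha, haz⟩ := (eq_bot_or_exists_atom_le z).resolve_left hz0
    rcases eq_or_ne z ⊤ with rfl | hz1
    · exact ⟨a, ha, Or.inr (Or.inl rfl)⟩
    · exact ⟨a, ha, Or.inr (Or.inr ⟨a, haz, linked_self ha (ne_top_of_le_ne_top hz1 haz)⟩)⟩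

theorem exists_orderIso_kSum_of_component [Finite P] [Nontrivial P] [IsTrans P Linked]
    (hQ : ∀ a : P, IsAtom a → Nonempty (component a ≃o Q)) :
    ∃ k : ℕ, 0 < k ∧ Nonempty (P ≃o KSum k Q) := by
  let ι : Set (Set P) := component '' {a : P | IsAtom a}
  have e (C : ι) : ∃ f : Q → P, Set.range f = C ∧ (∀ p q, f p ≤ f q ↔ p ≤ q) ∧ f ⊥ = ⊥ ∧
      f ⊤ = ⊤ := by
    obtain ⟨_, a, ha, rfl⟩ := C
    obtain ⟨e⟩ := hQ a ha
    refine ⟨fun q => e.symm q, ?_, fun p q => e.symm.le_iff_le, ?_, ?_⟩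
    · exact (e.symm.surjective.range_comp Subtype.val).trans Subtype.range_coe
    · exact congrArg Subtype.val e.symm.map_bot
    · exact congrArg Subtype.val e.symm.map_top
  choose φ φ_range φ_le φ_bot φ_top using e
  have φ_mem (C : ι) (q : Q) : φ C q ∈ C.1 := φ_range C ▸ Set.mem_range_self q
  have φ_injective (C : ι) : Function.Injective (φ C) := fun p q hpq =>
    ((φ_le C p q).1 hpq.le).antisymm ((φ_le C q p).1 hpq.ge)
  have exists_mem (x : P) : ∃ C : ι, x ∈ C.1 :=
    let ⟨a, ha, hx⟩ := exists_mem_component x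
    ⟨⟨_, a, ha, rfl⟩, hx⟩
  have : Nonempty ι := ⟨(exists_mem ⊥).choose⟩
  refine exists_orderIso_kSum φ (fun C D p q => ⟨fun hpq => ?_, ?_⟩) fun x => ?_
  · by_contra! hne
    have hCD : C = D := by
      obtain ⟨a, -, hC⟩ := C.2
      obtain ⟨b, -, hD⟩ := D.2
      refine Subtype.ext (hC ▸ hD ▸ component_eq_of_le (hC ▸ φ_mem C p) (hD ▸ φ_mem D q) ?_ ?_ hpq)
      · exact fun h0 => hne.1 (φ_injective _ (h0.trans (φ_bot _).symm))
      · exact fun h1 => hne.2.1 (φ_injective _ (h1.trans (φ_top _).symm))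
    subst hCD
    exact hne.2.2 rfl ((φ_le C p q).1 hpq)
  · rintro (rfl | rfl | ⟨rfl, hpq⟩)
    · exact (φ_bot C).trans_le bot_le
    · exact le_top.trans_eq (φ_top D).symm
    · exact (φ_le C p q).2 hpq
  · obtain ⟨C, hx⟩ := exists_mem x
    rw [← φ_range C] at hx
    exact ⟨C, hx⟩

end Summation

section BooleanComponents

variable {P : Type*} [PartialOrder P] [BoundedOrder P] [Fintype P] [GradeMinOrder ℕ P]
  {a b c e f z w : P} {N : ℕ}

namespace HasBooleanIntervals

variable (h : HasBooleanIntervals P N)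
include h

theorem card_intervalAtoms_bot (hN : 2 ≤ N) (ha : IsAtom a) (hae : a ⋖ e) :
    (intervalAtoms ⊥ e).card = 2 := by
  have hge := grade_eq_succ_of_covBy hae
  rw [grade_eq_one ha] at hge
  rw [h.card_intervalAtoms bot_le (by omega), hge, grade_bot, Nat.bot_eq_zero]

theorem exists_atom_ne_le (hN : 2 ≤ N) (ha : IsAtom a) (hae : a ⋖ e) :
    ∃ b ≠ a, IsAtom b ∧ b ≤ e := by
  obtain ⟨b, hb, hba⟩ := Finset.exists_mem_ne
    (Nat.one_lt_two.trans_eq (h.card_intervalAtoms_bot hN ha hae).symm) a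
  rw [mem_intervalAtoms, bot_covBy_iff] at hb
  exact ⟨b, hba, hb⟩

theorem intervalAtoms_bot_eq_pair [DecidableEq P] (hN : 2 ≤ N) (ha : IsAtom a) (hb : IsAtom b)
    (hba : b ≠ a) (hae : a ⋖ e) (hbe : b ≤ e) : intervalAtoms ⊥ e = {a, b} := by
  refine (Finset.eq_of_subset_of_card_le ?_ ?_).symm
  · simp only [Finset.insert_subset_iff, Finset.singleton_subset_iff, mem_intervalAtoms,
      bot_covBy_iff]
    exact ⟨⟨ha, hae.le⟩, hb, hbe⟩
  · rw [h.card_intervalAtoms_bot hN ha hae, Finset.card_pair hba.symm]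

variable (htop : grade ℕ (⊤ : P) = N + 1)
include htop

theorem exists_covBy_le_of_linked (hab : Linked a b) (hba : b ≠ a) (haz : a ≤ z) (hbz : b ≤ z) :
    ∃ e ≤ z, a ⋖ e ∧ b ≤ e := by
  classical
  obtain ⟨ha, hb, v, hv, hav, hbv⟩ := hab
  obtain ⟨w, hw, haw, hbw, hwz⟩ : ∃ w < ⊤, a ≤ w ∧ b ≤ w ∧ w ≤ z := by
    rcases eq_or_ne z ⊤ with rfl | hz
    · exact ⟨v, hv, hav, hbv, le_top⟩
    · exact ⟨z, hz.lt_top, haz, hbz, le_rfl⟩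
  have hgw := grade_strictMono (𝕆 := ℕ) hw
  obtain ⟨e, ⟨-, hew⟩, heT, hge⟩ := h.exists_intervalAtoms_eq (T := {a, b}) (by omega)
    (bot_le (a := w)) (by
      simp only [Finset.insert_subset_iff, Finset.singleton_subset_iff, mem_intervalAtoms,
        bot_covBy_iff]
      exact ⟨⟨ha, haw⟩, hb, hbw⟩)
  have hae : a ∈ intervalAtoms ⊥ e := by simp [heT]
  have hbe : b ∈ intervalAtoms ⊥ e := by simp [heT]
  rw [mem_intervalAtoms] at hae hbe
  refine ⟨e, hew.trans hwz, covBy_of_le_of_grade_eq_succ hae.2 ?_, hbe.2⟩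
  rw [hge, Finset.card_pair hba.symm, grade_eq_succ_of_covBy hae.1]

theorem exists_lt_top_of_covBy (hN : 3 ≤ N) (ha : IsAtom a) (hae : a ⋖ e) (haf : a ⋖ f) :
    ∃ g < ⊤, e ≤ g ∧ f ≤ g := by
  classical
  have hga := grade_eq_one ha
  obtain ⟨g, -, hgT, hgg⟩ := h.exists_intervalAtoms_eq (T := {e, f}) (by omega)
    (le_top (a := a)) (by
      simp only [Finset.insert_subset_iff, Finset.singleton_subset_iff, mem_intervalAtoms]
      exact ⟨⟨hae, le_top⟩, haf, le_top⟩)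
  have heg : e ∈ intervalAtoms a g := by simp [hgT]
  have hfg : f ∈ intervalAtoms a g := by simp [hgT]
  have hcard : Finset.card {e, f} ≤ 2 := Finset.card_le_two
  exact ⟨g, lt_of_le_of_grade_lt le_top (by omega), (mem_intervalAtoms.1 heg).2,
    (mem_intervalAtoms.1 hfg).2⟩

theorem linked_of_covBy (hN : 3 ≤ N) (hb : IsAtom b) (ha : IsAtom a) (hc : IsAtom c) (hbe : b ⋖ e)
    (hbf : b ⋖ f) (hae : a ≤ e) (hcf : c ≤ f) : Linked a c := by
  obtain ⟨g, hg, heg, hfg⟩ := h.exists_lt_top_of_covBy htop hN hb hbe hbf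
  exact ⟨ha, hc, g, hg, hae.trans heg, hcf.trans hfg⟩

theorem isTrans_linked (hN : 3 ≤ N) : IsTrans P Linked where
  trans a b c hab hbc := by
    rcases eq_or_ne a b with rfl | hne
    · exact hbc
    rcases eq_or_ne c b with rfl | hne'
    · exact hab
    obtain ⟨e, -, hbe, hae⟩ := h.exists_covBy_le_of_linked htop hab.symm hne le_top le_top
    obtain ⟨f, -, hbf, hcf⟩ := h.exists_covBy_le_of_linked htop hbc hne' le_top le_top
    exact h.linked_of_covBy htop hN hbc.1 hab.1 hbc.2.1 hbe hbf hae hcf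

theorem eq_of_covBy_of_le (hN : 3 ≤ N) (ha : IsAtom a) (hb : IsAtom b) (hba : b ≠ a) (hae : a ⋖ e)
    (haf : a ⋖ f) (hbe : b ≤ e) (hbf : b ≤ f) : e = f := by
  classical
  obtain ⟨g, hg, heg, hfg⟩ := h.exists_lt_top_of_covBy htop hN ha hae haf
  have hgg := grade_strictMono (𝕆 := ℕ) hg
  have hatoms : intervalAtoms ⊥ e = intervalAtoms ⊥ f := by
    rw [h.intervalAtoms_bot_eq_pair (by omega) ha hb hba hae hbe,
      h.intervalAtoms_bot_eq_pair (by omega) ha hb hba haf hbf]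
  exact (h.le_of_intervalAtoms_subset (by omega) ⟨bot_le, heg⟩ ⟨bot_le, hfg⟩ hatoms.subset).antisymm
    (h.le_of_intervalAtoms_subset (by omega) ⟨bot_le, hfg⟩ ⟨bot_le, heg⟩ hatoms.superset)

/-- Every cover of `a` lies above exactly one other atom, which is then linked to `a`. -/
theorem ncard_linked (hN : 3 ≤ N) (ha : IsAtom a) : {b | Linked a b}.ncard = N + 1 := by
  have hga := grade_eq_one ha
  have ha_self : a ∈ {b | Linked a b} := linked_self ha (by rintro rfl; omega)
  choose! φ φ_covBy le_φ using fun b (hb : b ∈ {b | Linked a b} \ {a}) =>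
    (h.exists_covBy_le_of_linked htop hb.1 hb.2 le_top le_top).imp fun _ => And.right
  rw [← Set.ncard_sdiff_singleton_add_one ha_self, Nat.add_right_cancel_iff]
  trans (intervalAtoms a ⊤ : Set P).ncard
  · refine Set.ncard_congr (fun b _ => φ b) (fun b hb => ?_) (fun b c hb hc hbc => ?_)
      fun e he => ?_
    · exact mem_intervalAtoms.2 ⟨φ_covBy b hb, le_top⟩
    · classical
      by_contra hne
      have hmem : c ∈ intervalAtoms ⊥ (φ b) :=
        mem_intervalAtoms.2 ⟨hc.1.2.1.bot_covBy, (le_φ c hc).trans_eq hbc.symm⟩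
      rw [h.intervalAtoms_bot_eq_pair (by omega) ha hb.1.2.1 hb.2 (φ_covBy b hb) (le_φ b hb),
        Finset.mem_insert, Finset.mem_singleton] at hmem
      exact hmem.elim hc.2 (Ne.symm hne)
    · rw [Finset.mem_coe, mem_intervalAtoms] at he
      obtain ⟨b, hba, hb, hbe⟩ := h.exists_atom_ne_le (by omega) ha he.1
      have hb' : b ∈ {b | Linked a b} \ {a} :=
        ⟨h.linked_of_covBy htop hN ha ha hb he.1 he.1 he.1.le hbe, hba⟩
      exact ⟨b, hb', h.eq_of_covBy_of_le htop hN ha hb hba (φ_covBy b hb') he.1 (le_φ b hb') hbe⟩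
  · rw [Set.ncard_coe_finset, h.card_intervalAtoms le_top (by omega)]
    omega

theorem le_of_linked_le (hN : 3 ≤ N) (ha : IsAtom a) (hz : z ∈ component a)
    (hzw : ∀ b, Linked a b → b ≤ z → b ≤ w) : z ≤ w := by
  have hga := grade_eq_one ha
  have := h.isTrans_linked htop hN
  rcases eq_or_ne z ⊥ with rfl | hz0
  · exact bot_le
  obtain ⟨b, hbz, hab⟩ : ∃ b ≤ z, Linked a b := by
    rcases hz.resolve_left hz0 with rfl | hab
    · exact ⟨a, le_top, linked_self ha (by rintro rfl; omega)⟩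
    · exact hab
  have hbw := hzw b hab hbz
  have hgb := grade_eq_one hab.2.1
  refine h.le_of_intervalAtoms_subset (v := ⊤) (by omega) ⟨hbz, le_top⟩ ⟨hbw, le_top⟩ fun e he => ?_
  rw [mem_intervalAtoms] at he ⊢
  obtain ⟨d, hdb, hd, hde⟩ := h.exists_atom_ne_le (by omega) hab.2.1 he.1
  have hbd : Linked b d := h.linked_of_covBy htop hN hab.2.1 hab.2.1 hd he.1 he.1 he.1.le hde
  obtain ⟨f, hfw, hbf, hdf⟩ := h.exists_covBy_le_of_linked htop hbd hdb hbw
    (hzw d (_root_.trans hab hbd) (hde.trans he.2))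
  exact ⟨he.1, (h.eq_of_covBy_of_le htop hN hab.2.1 hd hdb he.1 hbf hde hdf).trans_le hfw⟩

theorem exists_linked_le_eq (hN : 3 ≤ N) {T : Set P} (hT : T ⊆ {b | Linked a b}) :
    ∃ z ∈ component a, {b | Linked a b ∧ b ≤ z} = T := by
  classical
  have := h.isTrans_linked htop hN
  rcases T.eq_empty_or_nonempty with rfl | ⟨b, hbT⟩
  · exact ⟨⊥, Or.inl rfl, Set.eq_empty_of_forall_notMem fun b hb => hb.1.2.1.1 (le_bot_iff.1 hb.2)⟩
  have hab := hT hbT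
  have hgb := grade_eq_one hab.2.1
  obtain ⟨z, ⟨hbz, -⟩, hzS, -⟩ := h.exists_intervalAtoms_eq
    (T := {e ∈ intervalAtoms b ⊤ | ∃ d ∈ T, d ≠ b ∧ d ≤ e}) (by omega) le_top
    (Finset.filter_subset _ _)
  refine ⟨z, Or.inr (Or.inr ⟨b, hbz, hab⟩), Set.Subset.antisymm ?_ fun d hd => ⟨hT hd, ?_⟩⟩
  · rintro d ⟨had, hdz⟩
    rcases eq_or_ne d b with rfl | hdb
    · exact hbT
    obtain ⟨e, hez, hbe, hde⟩ :=
      h.exists_covBy_le_of_linked htop (_root_.trans hab.symm had) hdb hbz hdz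
    have heS : e ∈ intervalAtoms b z := mem_intervalAtoms.2 ⟨hbe, hez⟩
    rw [hzS, Finset.mem_filter] at heS
    obtain ⟨-, d', hd'T, hd'b, hd'e⟩ := heS
    have hmem : d ∈ intervalAtoms ⊥ e := mem_intervalAtoms.2 ⟨had.2.1.bot_covBy, hde⟩
    rw [h.intervalAtoms_bot_eq_pair (by omega) hab.2.1 (hT hd'T).2.1 hd'b hbe hd'e,
      Finset.mem_insert, Finset.mem_singleton] at hmem
    exact hmem.resolve_left hdb ▸ hd'T
  · rcases eq_or_ne d b with rfl | hdb
    · exact hbz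
    obtain ⟨e, -, hbe, hde⟩ := h.exists_covBy_le_of_linked htop
      (_root_.trans hab.symm (hT hd)) hdb le_top le_top
    have heS : e ∈ intervalAtoms b z :=
      hzS ▸ Finset.mem_filter.2 ⟨mem_intervalAtoms.2 ⟨hbe, le_top⟩, d, hd, hdb, hde⟩
    exact hde.trans (mem_intervalAtoms.1 heS).2

theorem nonempty_component_orderIso (hN : 3 ≤ N) (ha : IsAtom a) :
    Nonempty (component a ≃o BooleanLattice (N + 1)) := by
  let f : component a ↪o Set {b | Linked a b} := OrderEmbedding.ofMapLEIff
    (fun z => {b | b.1 ≤ z}) fun z w =>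
      ⟨fun hzw => h.le_of_linked_le htop hN ha z.2 fun b hb hbz => hzw (a := ⟨b, hb⟩) hbz,
        fun hzw b hbz => le_trans (α := P) hbz hzw⟩
  have f_surjective : Function.Surjective f := fun T => by
    obtain ⟨z, hz, hzT⟩ := h.exists_linked_le_eq htop hN (T := Subtype.val '' T)
      (Subtype.coe_image_subset _ T)
    refine ⟨⟨z, hz⟩, Set.ext fun b => ?_⟩
    rw [← Subtype.val_injective.mem_set_image (s := T), ← hzT]
    exact (and_iff_right b.2).symm
  let e : {b | Linked a b} ≃ Fin (N + 1) := Finite.equivFinOfCardEq (h.ncard_linked htop hN ha)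
  exact ⟨((RelIso.ofSurjective f f_surjective).trans e.toOrderIsoSet).trans
    Fintype.finsetOrderIsoSet.symm⟩

theorem exists_orderIso_kSum_booleanLattice (hN : 3 ≤ N) :
    ∃ k : ℕ, 0 < k ∧ Nonempty (P ≃o KSum k (BooleanLattice (N + 1))) := by
  have := h.isTrans_linked htop hN
  have : Nontrivial P := ⟨⊥, ⊤, fun hbt => by simp [← hbt] at htop⟩
  exact exists_orderIso_kSum_of_component fun a ha => h.nonempty_component_orderIso htop hN ha

end HasBooleanIntervals

end BooleanComponents

section ButterflyLevel

variable {Q R : Type*} [PartialOrder Q] [BoundedOrder Q] [PartialOrder R] [BoundedOrder R]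
  {f : Q → ℕ} {g : R → ℕ} {n : ℕ}

/-- `f` is the rank function of a butterfly poset of rank `n`: it determines the order, and takes
each value strictly between `0` and `n` exactly twice. -/
structure IsButterflyLevel (f : Q → ℕ) (n : ℕ) : Prop where
  lt_iff_lt : ∀ x y, x < y ↔ f x < f y
  map_bot : f ⊥ = 0
  map_top : f ⊤ = n
  ncard_fiber : ∀ i, 0 < i → i < n → {x | f x = i}.ncard = 2

namespace IsButterflyLevel

theorem le (hf : IsButterflyLevel f n) (x : Q) : f x ≤ n := by
  rw [← hf.map_top, ← not_lt, ← hf.lt_iff_lt]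
  exact not_top_lt

theorem eq_zero_iff (hf : IsButterflyLevel f n) {x : Q} : f x = 0 ↔ x = ⊥ := by
  rw [← not_bot_lt_iff, hf.lt_iff_lt, hf.map_bot, Nat.pos_iff_ne_zero, not_not]

theorem eq_iff (hf : IsButterflyLevel f n) {x : Q} : f x = n ↔ x = ⊤ := by
  rw [← not_lt_top_iff, hf.lt_iff_lt, hf.map_top, not_lt, (hf.le x).ge_iff_eq', eq_comm]

theorem ncard_fiber_eq (hf : IsButterflyLevel f n) (i : ℕ) :
    {x | f x = i}.ncard = if i = 0 ∨ i = n then 1 else if i < n then 2 else 0 := by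
  split_ifs with hi hi'
  · rcases hi with rfl | rfl
    · simp only [hf.eq_zero_iff, Set.ofPred_eq_eq_singleton, Set.ncard_singleton]
    · simp only [hf.eq_iff, Set.ofPred_eq_eq_singleton, Set.ncard_singleton]
  · exact hf.ncard_fiber i (by omega) hi'
  · rw [Set.eq_empty_of_forall_notMem (s := {x | f x = i}), Set.ncard_empty]
    rintro x rfl
    have := hf.le x
    omega

theorem nonempty_orderIso [Finite Q] [Finite R] (hf : IsButterflyLevel f n)
    (hg : IsButterflyLevel g n) : Nonempty (Q ≃o R) := by
  let e : Q ≃ R := Equiv.ofFiberEquiv (f := f) (g := g) fun i =>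
    Nonempty.some <| (Finite.card_eq (α := {x | f x = i}) (β := {x | g x = i})).1 <|
      (hf.ncard_fiber_eq i).trans (hg.ncard_fiber_eq i).symm
  have map_e (x : Q) : g (e x) = f x := Equiv.ofFiberEquiv_map _ x
  refine ⟨e, fun {x y} => ?_⟩
  rw [le_iff_eq_or_lt, le_iff_eq_or_lt, e.injective.eq_iff, hg.lt_iff_lt, hf.lt_iff_lt, map_e,
    map_e]

end IsButterflyLevel

theorem ButterflyCore.lt_iff {l : ℕ} {c d : ButterflyCore l} : c < d ↔ c.level < d.level :=
  ⟨fun h => (h.le.resolve_left h.ne), fun h => lt_of_le_of_ne (Or.inr h) (by rintro rfl; simp at h)⟩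

/-- The rank of an element of the butterfly poset. -/
def butterflyLevel (n : ℕ) : Butterfly n → ℕ :=
  WithBot.recBotCoe 0 (WithTop.recTopCoe n fun c => c.level + 1)

@[simp]
theorem butterflyLevel_bot : butterflyLevel n ⊥ = 0 := rfl

@[simp]
theorem butterflyLevel_top : butterflyLevel n ⊤ = n := rfl

@[simp]
theorem butterflyLevel_coe (c : ButterflyCore (n - 1)) :
    butterflyLevel n ((c : WithTop (ButterflyCore (n - 1))) : Butterfly n) = c.level + 1 := rfl

theorem butterfly_eq_bot_or_eq_top_or_eq_coe (p : Butterfly n) : p = ⊥ ∨ p = ⊤ ∨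
    ∃ c : ButterflyCore (n - 1), p = (c : WithTop (ButterflyCore (n - 1))) := by
  induction p using WithBot.recBotCoe with
  | bot => exact Or.inl rfl
  | coe p =>
    induction p using WithTop.recTopCoe with
    | top => exact Or.inr (Or.inl rfl)
    | coe c => exact Or.inr (Or.inr ⟨c, rfl⟩)

theorem isButterflyLevel_butterflyLevel (hn : 0 < n) : IsButterflyLevel (butterflyLevel n) n where
  lt_iff_lt p q := by
    have level_succ_lt (c : ButterflyCore (n - 1)) : (c.level : ℕ) + 1 < n := by omega
    have level_lt (c : ButterflyCore (n - 1)) : (c.level : ℕ) < n := by omega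
    have coe_lt_top (c : ButterflyCore (n - 1)) :
        ((c : WithTop (ButterflyCore (n - 1))) : Butterfly n) < ⊤ :=
      WithBot.coe_lt_coe.2 (WithTop.coe_lt_top c)
    rcases butterfly_eq_bot_or_eq_top_or_eq_coe p with rfl | rfl | ⟨c, rfl⟩ <;>
    rcases butterfly_eq_bot_or_eq_top_or_eq_coe q with rfl | rfl | ⟨d, rfl⟩ <;>
    simp [hn, ButterflyCore.lt_iff, level_succ_lt, level_lt, coe_lt_top]
  map_bot := rfl
  map_top := rfl
  ncard_fiber i hi0 hin := by
    let c (s : Fin 2) : Butterfly n :=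
      ((⟨⟨i - 1, by omega⟩, s⟩ : ButterflyCore (n - 1)) : WithTop (ButterflyCore (n - 1)))
    have hfiber : {q | butterflyLevel n q = i} = {c 0, c 1} := by
      ext q
      rcases butterfly_eq_bot_or_eq_top_or_eq_coe q with rfl | rfl | ⟨⟨l, s⟩, rfl⟩
      · simp [c, hi0.ne]
      · simp [c, hin.ne']
      · have hl : (l : ℕ) + 1 = i ↔ l = ⟨i - 1, by omega⟩ ∧ (s = 0 ∨ s = 1) := by
          rw [and_iff_left (by omega), Fin.ext_iff]
          change (l : ℕ) + 1 = i ↔ (l : ℕ) = i - 1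
          omega
        simpa [c, ButterflyCore.ext_iff, ← and_or_left] using hl
    rw [hfiber, Set.ncard_pair]
    simp [c]

instance (l : ℕ) : Finite (ButterflyCore l) :=
  Finite.of_injective (fun c => (c.level, c.side)) fun _ _ h =>
    ButterflyCore.ext (congrArg Prod.fst h) (congrArg Prod.snd h)

theorem IsButterflyLevel.nonempty_orderIso_butterfly [Finite Q] (hf : IsButterflyLevel f n)
    (hn : 0 < n) : Nonempty (Q ≃o Butterfly n) :=
  hf.nonempty_orderIso (isButterflyLevel_butterflyLevel hn)

end ButterflyLevel

section ButterflyComponents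

variable {P : Type*} [PartialOrder P] [BoundedOrder P] [GradeMinOrder ℕ P] {a b z w : P} {N : ℕ}

theorem mem_component_iff_of_grade_eq_one (htop : grade ℕ (⊤ : P) ≠ 1) (hb : grade ℕ b = 1) :
    b ∈ component a ↔ Linked a b := by
  refine ⟨?_, fun hab => Or.inr (Or.inr ⟨b, le_rfl, hab⟩)⟩
  rintro (rfl | rfl | ⟨c, hcb, hac⟩)
  · simp at hb
  · exact absurd hb htop
  · rwa [← eq_of_le_of_grade_le hcb (hb.trans (grade_eq_one hac.2.1).symm).le]

namespace IsCoverRegular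

variable [Fintype P] {A : ℕ → ℕ} (h : IsCoverRegular P A) (hA : ∀ i, 2 ≤ i → i ≤ N → A i = 2)
  (hN : 3 ≤ N) (htop : grade ℕ (⊤ : P) = N + 1)
include h hA hN htop

theorem intervalAtoms_bot_eq_of_butterfly (hz1 : z < ⊤) (hw1 : w < ⊤) (hz : 2 ≤ grade ℕ z)
    (hw : 2 ≤ grade ℕ w) (ha : IsAtom a) (haz : a ≤ z) (haw : a ≤ w) :
    intervalAtoms ⊥ z = intervalAtoms ⊥ w := by
  refine h.intervalAtoms_eq_of_mem_of_butterfly hA hN ?_ hz1 hw1 ?_ ?_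
    (mem_intervalAtoms.2 ⟨ha.bot_covBy, haz⟩) (mem_intervalAtoms.2 ⟨ha.bot_covBy, haw⟩) <;>
  simpa only [grade_bot, Nat.bot_eq_zero, Nat.zero_add]

theorem le_of_linked_of_butterfly (hab : Linked a b) (hz : 2 ≤ grade ℕ z) (haz : a ≤ z) :
    b ≤ z := by
  obtain ⟨ha, hb, w, hw1, haw, hbw⟩ := hab
  rcases eq_or_ne z ⊤ with rfl | hz1
  · exact le_top
  rcases eq_or_ne a w with rfl | hne
  · rwa [(ha.le_iff_eq hb.1).1 hbw]
  have hgw := grade_strictMono (𝕆 := ℕ) (haw.lt_of_ne hne)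
  rw [grade_eq_one ha] at hgw
  have hbmem : b ∈ intervalAtoms ⊥ w := mem_intervalAtoms.2 ⟨hb.bot_covBy, hbw⟩
  rw [h.intervalAtoms_bot_eq_of_butterfly hA hN htop hw1 hz1.lt_top hgw hz ha haw haz] at hbmem
  exact (mem_intervalAtoms.1 hbmem).2

theorem isTrans_linked_of_butterfly : IsTrans P Linked where
  trans a b c hab hbc := by
    obtain ⟨z, ⟨hbz, -⟩, hz⟩ := exists_mem_Icc_grade_eq (le_top (a := b)) (i := 2)
      (by rw [grade_eq_one hbc.1]; omega) (by omega)
    exact ⟨hab.1, hbc.2.1, z, lt_of_le_of_grade_lt le_top (by omega),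
      h.le_of_linked_of_butterfly hA hN htop hab.symm hz.ge hbz,
      h.le_of_linked_of_butterfly hA hN htop hbc hz.ge hbz⟩

theorem le_of_grade_lt_of_mem_component (hz : z ∈ component a) (hw : w ∈ component a)
    (hzw : grade ℕ z < grade ℕ w) : z ≤ w := by
  have := h.isTrans_linked_of_butterfly hA hN htop
  rcases hz with rfl | rfl | ⟨b, hbz, hab⟩
  · exact bot_le
  · exact absurd (grade_mono (𝕆 := ℕ) le_top) hzw.not_ge
  rcases hw with rfl | rfl | ⟨c, hcw, hac⟩
  · exact absurd (grade_mono (𝕆 := ℕ) bot_le) hzw.not_ge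
  · exact le_top
  have hgb := grade_eq_one hab.2.1
  have hgz := grade_mono (𝕆 := ℕ) hbz
  have hbw : b ≤ w :=
    h.le_of_linked_of_butterfly hA hN htop (_root_.trans hac.symm hab) (by omega) hcw
  exact h.le_of_grade_lt_of_butterfly hA (v := ⊤) (by omega) ⟨hbz, le_top⟩ ⟨hbw, le_top⟩ hzw

theorem linked_iff_of_butterfly (ha : IsAtom a) (hz1 : z < ⊤) (hz : 2 ≤ grade ℕ z) (haz : a ≤ z) :
    Linked a b ↔ b ∈ intervalAtoms ⊥ z := by
  rw [mem_intervalAtoms, bot_covBy_iff]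
  exact ⟨fun hab => ⟨hab.2.1, h.le_of_linked_of_butterfly hA hN htop hab hz haz⟩,
    fun hb => ⟨ha, hb.1, z, hz1, haz, hb.2⟩⟩

theorem mem_component_iff_of_butterfly (ha : IsAtom a) (hz : 2 ≤ grade ℕ z) :
    z ∈ component a ↔ a ≤ z := by
  refine ⟨?_, fun haz => Or.inr (Or.inr ⟨a, haz, linked_self ha ?_⟩)⟩
  · rintro (rfl | rfl | ⟨b, hbz, hab⟩)
    · rw [grade_bot, Nat.bot_eq_zero] at hz
      omega
    · exact le_top
    · exact h.le_of_linked_of_butterfly hA hN htop hab.symm hz hbz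
  · rintro rfl
    have := grade_eq_one ha
    omega

theorem ncard_grade_eq_of_mem_component (ha : IsAtom a) {i : ℕ} (hi0 : 0 < i) (hi : i < N + 1) :
    {z | z ∈ component a ∧ grade ℕ z = i}.ncard = 2 := by
  have hga := grade_eq_one ha
  obtain rfl | hi2 := (Nat.succ_le_of_lt hi0).eq_or_lt
  · obtain ⟨z, ⟨haz, -⟩, hz⟩ :=
      exists_mem_Icc_grade_eq (le_top (a := a)) (i := 2) (by omega) (by omega)
    have hz1 : z < ⊤ := lt_of_le_of_grade_lt le_top (by omega)
    have hset : {b | b ∈ component a ∧ grade ℕ b = 1} = intervalAtoms ⊥ z := by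
      ext b
      rw [Finset.mem_coe, ← h.linked_iff_of_butterfly hA hN htop ha hz1 hz.ge haz]
      have hmem := mem_component_iff_of_grade_eq_one (P := P) (a := a) (b := b) (by omega)
      exact ⟨fun hb => (hmem hb.2).1 hb.1,
        fun hb => ⟨(hmem (grade_eq_one hb.2.1)).2 hb, grade_eq_one hb.2.1⟩⟩
    rw [hset, Set.ncard_coe_finset, h.card_intervalAtoms (ha.bot_lt.trans_le haz), hz, grade_bot]
    exact hA 2 le_rfl (by omega)
  · have hset : {z | z ∈ component a ∧ grade ℕ z = i} = level a ⊤ (i - 1) := by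
      ext z
      rw [Finset.mem_coe, mem_level, Set.mem_ofPred_eq, hga,
        show 1 + (i - 1) = i by omega]
      have hmem := h.mem_component_iff_of_butterfly hA hN htop ha (z := z)
      exact ⟨fun hz => ⟨(hmem (by omega)).1 hz.1, le_top, hz.2⟩,
        fun hz => ⟨(hmem (by omega)).2 hz.1, hz.2.2⟩⟩
    rw [hset, Set.ncard_coe_finset]
    exact h.card_level_of_butterfly hA (r := N) (by omega)
      (lt_of_le_of_grade_lt le_top (by omega)) le_rfl (by omega) (by omega)

theorem isButterflyLevel_component (ha : IsAtom a) :
    IsButterflyLevel (fun z : component a => grade ℕ z.1) (N + 1) where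
  lt_iff_lt z w := ⟨fun hzw => grade_strictMono hzw, fun hzw =>
    lt_of_le_of_grade_lt (P := P) (h.le_of_grade_lt_of_mem_component hA hN htop z.2 w.2 hzw) hzw⟩
  map_bot := grade_bot
  map_top := htop
  ncard_fiber i hi0 hi := by
    rw [← h.ncard_grade_eq_of_mem_component hA hN htop ha hi0 hi,
      ← Set.ncard_image_of_injective _ Subtype.val_injective]
    congr 1
    ext z
    simp [and_comm]

theorem exists_orderIso_kSum_butterfly :
    ∃ k : ℕ, 0 < k ∧ Nonempty (P ≃o KSum k (Butterfly (N + 1))) := by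
  have := h.isTrans_linked_of_butterfly hA hN htop
  have : Nontrivial P := ⟨⊥, ⊤, fun hbt => by simp [← hbt] at htop⟩
  exact exists_orderIso_kSum_of_component fun a ha =>
    (h.isButterflyLevel_component hA hN htop ha).nonempty_orderIso_butterfly N.succ_pos

end IsCoverRegular

end ButterflyComponents

end FinPoset

theorem theorem3p7 {P : Type*} [PartialOrder P] [BoundedOrder P] [Finite P]
    (hB : FinPoset.IsBinomial P) (hE : FinPoset.IsEulerian P)
    (n m : ℕ) (hnm : n = 2 * m + 1) (hn : 5 ≤ n) (hrank : FinPoset.HasRank P n) :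
    (∃ k : ℕ, 0 < k ∧ Nonempty (P ≃o FinPoset.KSum k (FinPoset.BooleanLattice n))) ∨
      (∃ k : ℕ, 0 < k ∧ Nonempty (P ≃o FinPoset.KSum k (FinPoset.Butterfly n))) := by
  subst hnm
  have := Fintype.ofFinite P
  let := hB.gradeMinOrder
  have htop := FinPoset.grade_top_of_hasRank hrank
  obtain ⟨A, h⟩ := hB.exists_isCoverRegular
  rcases h.atomFunction_dichotomy hE (j := m) (by omega) (by omega) with hA | hA
  · left
    exact (h.hasBooleanIntervals hA).exists_orderIso_kSum_booleanLattice htop (by omega)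
  · right
    exact h.exists_orderIso_kSum_butterfly hA (by omega) htop
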